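/- Let $n\ge 1$ and $[n]=\{1,\dots,n\}$. Consider the hyperplane arrangements in $\mathbb R^n$ $$\mathrm{Shi}(n)=\{x_i-x_j=0,\ x_i-x_j=1 : 1\le i<j\le n\},\qquad \mathrm{Ish}(n)=\{x_i-x_j=0,\ x_1-x_j=i : 1\le i<j\le n\}.$$ A region of an arrangement is a connected component of the complement of its hyperplanes. A ceiling of a region $R$ is a hyperplane of the arrangement that does not contain the origin, is the affine span of a facet of $R$, and does not separate $R$ from the origin. For a region $R$ of either arrangement let $\pi=\pi_1\cdots\pi_n$ be the permutation of $[n]$ such that $x_{\pi_1}>\dots>x_{\pi_n}$ on $R$, and let $\pi^{-1}_i$ be the position of $i$ in $\pi$. **The map $\rho$.** Let $B_n=\{(i,j): 2\le i\le n,\ 1\le j\le n+i-1\}$ ($i$ is the column and $j$ the height). A rook placement on $B_n$ is a subset of $B_n$ with no two squares in the same row or column; it is maximal if it is maximal under inclusion. For a region $R$ of $\mathrm{Ish}(n)$ put $\epsilon_k=i$ if $x_1-x_{\pi_k}=i$ is a ceiling of $R$, and $\epsilon_k=0$ if there is no such $i$. Then $\rho(R)$ is the maximal rook placement on $B_n$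 with one rook in each column $i=2,\dots,n$, at height $\pi^{-1}_i$ if $\epsilon_{\pi^{-1}_i}=0$ and at height $n+\epsilon_{\pi^{-1}_i}$ otherwise. **The map $\alpha$.** A parking function of size $n$ is a word $w_1\cdots w_n$ with letters in $[n]$ whose nondecreasing rearrangement $a_1\le\dots\le a_n$ satisfies $a_i\le i$ for all $i$; $\mathrm{Park}_n$ is the set of these. The group $\mathbb Z_{n+1}$ acts on $[n+1]^n$ by adding a constant to all letters modulo $n+1$; each orbit contains exactly one parking function (Cycle Lemma). Given a maximal rook placement on $B_n$, fire a laser rightward from every rook, hitting all squares of $B_n$ strictly to the right of the rook in its row. Let $v_1=1$ and, for $2\le i\le n$, let $v_i$ be the number of squares of column $i$ weakly below the rook of that column that contain no laser fire. Then $\alpha$ sends the placement to the parking function in the $\mathbb Z_{n+1}$-orbit of $v_1\cdots v_n$. **The map $\omega$.** For a region $R$ of $\mathrm{Shi}(n)$ let $\Pi$ be the set partition of $[n]$ generated by $a\sim b$ whenever $x_{\pi_a}-x_{\pi_b}=1$ is a ceiling of $R$, and let $w_i$ be the smallest element of the block of $\Pi$ containing $\pi^{-1}_i$. The map $R\mapsto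 w_1\cdots w_n$ is a bijection from the regions of $\mathrm{Shi}(n)$ to $\mathrm{Park}_n$; let $\omega$ be its inverse. **Theorem.** The composition $\omega\circ\alpha\circ\rho$ is a bijection from the set of regions of $\mathrm{Ish}(n)$ to the set of regions of $\mathrm{Shi}(n)$. -/

import Mathlib

/-!
Words, positions and letters are indexed by `Fin n`; the index `i : Fin n` stands for the
integer `i + 1` of `[n] = {1, …, n}`.  Heights, letters of words and squares of boards are natural
numbers, written with their true (one-based) values.
-/

namespace ShiIsh

noncomputable section

open Finset

/-! ### Hyperplane arrangements, regions and ceilings -/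

/-- The affine subspace `x_i - x_j = c` of `ℝⁿ`. -/
def diffHyperplane {n : ℕ} (i j : Fin n) (c : ℝ) : AffineSubspace ℝ (Fin n → ℝ) where
  carrier := {x | x i - x j = c}
  smul_vsub_vadd_mem' := by
    intro t p q r hp hq hr
    simp only [Set.mem_ofPred_eq, vsub_eq_sub, vadd_eq_add, Pi.add_apply, Pi.smul_apply,
      Pi.sub_apply, smul_eq_mul] at *
    linear_combination t * hp - t * hq + hr

/-- An arrangement in `ℝⁿ`, given as its set of hyperplanes. -/
abbrev Arrangement (n : ℕ) := Set (AffineSubspace ℝ (Fin n → ℝ))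

/-- The Coxeter arrangement `{x_i - x_j = 0 : 1 ≤ i < j ≤ n}`. -/
def cox (n : ℕ) : Arrangement n :=
  {H | ∃ i j : Fin n, i < j ∧ H = diffHyperplane i j 0}

/-- The Shi arrangement `Cox(n) ∪ {x_i - x_j = 1 : 1 ≤ i < j ≤ n}`. -/
def shi (n : ℕ) : Arrangement n :=
  cox n ∪ {H | ∃ i j : Fin n, i < j ∧ H = diffHyperplane i j 1}

/-- The Ish arrangement `Cox(n) ∪ {x_1 - x_j = i : 1 ≤ i < j ≤ n}`. -/
def ish (n : ℕ) [NeZero n] : Arrangement n :=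
  cox n ∪ {H | ∃ i j : Fin n, i < j ∧ H = diffHyperplane 0 j ((i : ℝ) + 1)}

/-- The complement of the union of the hyperplanes. -/
def complement {n : ℕ} (A : Arrangement n) : Set (Fin n → ℝ) :=
  {x | ∀ H ∈ A, x ∉ H}

/-- A region is a connected component of the complement of the hyperplanes. -/
def Region {n : ℕ} (A : Arrangement n) : Type :=
  {R : Set (Fin n → ℝ) // ∃ x ∈ complement A, R = connectedComponentIn (complement A) x}

/-- `H ∈ A` is a ceiling of `R` if it does not pass through the origin, is the affine span of a
facet of `R` (the facet cut out by `H` being `closure R ∩ H`), and does not separate `R` from the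
origin. -/
def IsCeiling {n : ℕ} (A : Arrangement n) (R : Set (Fin n → ℝ))
    (H : AffineSubspace ℝ (Fin n → ℝ)) : Prop :=
  H ∈ A ∧ (0 : Fin n → ℝ) ∉ H ∧ affineSpan ℝ (closure R ∩ (H : Set (Fin n → ℝ))) = H ∧
    ∀ x ∈ R, ¬ H.SOppSide 0 x

/-- `x_{π_1} > ⋯ > x_{π_n}` on `R`. -/
def IsOrder {n : ℕ} (R : Set (Fin n → ℝ)) (π : Equiv.Perm (Fin n)) : Prop :=
  ∀ x ∈ R, ∀ a b : Fin n, a < b → x (π b) < x (π a)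

theorem mem_diffHyperplane {n : ℕ} (i j : Fin n) (c : ℝ) (x : Fin n → ℝ) :
    x ∈ diffHyperplane i j c ↔ x i - x j = c := Iff.rfl

theorem Region.nonempty {n : ℕ} {A : Arrangement n} (R : Region A) : R.1.Nonempty := by
  obtain ⟨R, x, hx, rfl⟩ := R
  exact ⟨x, mem_connectedComponentIn hx⟩

theorem Region.subset {n : ℕ} {A : Arrangement n} (R : Region A) : R.1 ⊆ complement A := by
  obtain ⟨R, x, hx, rfl⟩ := R
  exact connectedComponentIn_subset _ _

theorem Region.lt_of_lt {n : ℕ} {A : Arrangement n} (R : Region A) {i j : Fin n} {c : ℝ}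
    (hA : diffHyperplane i j c ∈ A) {x y : Fin n → ℝ} (hx : x ∈ R.1) (hy : y ∈ R.1)
    (h : x i - x j < c) : y i - y j < c := by
  by_contra hc
  have hpre : IsPreconnected R.1 := by
    obtain ⟨R, z, hz, rfl⟩ := R
    exact isPreconnected_connectedComponentIn
  have hf : ContinuousOn (fun z : Fin n → ℝ => z i - z j) R.1 := by fun_prop
  obtain ⟨z, hz, hzc⟩ := hpre.intermediate_value hx hy hf ⟨h.le, not_lt.1 hc⟩
  exact R.subset hz _ hA hzc

theorem exists_isOrder {n : ℕ} {A : Arrangement n} (hA : cox n ⊆ A) (R : Region A) :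
    ∃! π : Equiv.Perm (Fin n), IsOrder R.1 π := by
  obtain ⟨x, hx⟩ := R.nonempty
  have hmem : ∀ i j : Fin n, i ≠ j →
      diffHyperplane i j 0 ∈ A := by
    intro i j hij
    rcases lt_or_gt_of_ne hij with h | h
    · exact hA ⟨i, j, h, rfl⟩
    · refine hA ⟨j, i, h, ?_⟩
      ext z
      simp only [mem_diffHyperplane]
      constructor <;> intro hz <;> linarith
  have hinj : ∀ i j : Fin n, x i = x j → i = j := by
    intro i j hij
    by_contra hne
    exact R.subset hx _ (hmem i j hne) (by rw [mem_diffHyperplane]; linarith)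
  have hanti : ∀ π : Equiv.Perm (Fin n), IsOrder R.1 π ↔ Monotone ((fun i => -x i) ∘ π) := by
    intro π
    constructor
    · intro h a b hab
      rcases hab.eq_or_lt with rfl | hlt
      · exact le_rfl
      · have := h x hx a b hlt
        simp only [Function.comp]
        linarith
    · intro h y hy a b hab
      have h1 := h hab.le
      simp only [Function.comp] at h1
      have hne : π b ≠ π a := fun h => hab.ne (π.injective h.symm)
      have h2 : x (π b) ≠ x (π a) := fun h => hne (hinj _ _ h)
      have h3 : x (π b) < x (π a) := lt_of_le_of_ne (by linarith) h2
      have := R.lt_of_lt (hmem _ _ hne) hx hy (by linarith)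
      linarith
  refine ⟨Tuple.sort (fun i => -x i), (hanti _).2 (Tuple.monotone_sort _), ?_⟩
  intro σ hσ
  have h := Tuple.unique_monotone ((hanti σ).1 hσ) (Tuple.monotone_sort (fun i => -x i))
  ext1 a
  have := congrFun h a
  simp only [Function.comp] at this
  exact hinj _ _ (by linarith)

theorem IsCeiling.sub_lt {n : ℕ} {A : Arrangement n} {R : Region A} {i j : Fin n} {c : ℝ}
    (hc : 0 < c) (h : IsCeiling A R.1 (diffHyperplane i j c)) {x : Fin n → ℝ} (hx : x ∈ R.1) :
    x i - x j < c := by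
  by_contra hlt
  have hne : x ∉ diffHyperplane i j c := R.subset hx _ h.1
  rw [mem_diffHyperplane] at hne
  have hgt : c < x i - x j := lt_of_le_of_ne (not_lt.1 hlt) (Ne.symm hne)
  refine h.2.2.2 x hx ⟨?_, h.2.1, hne⟩
  rw [AffineSubspace.wOppSide_iff_exists_wbtw]
  have hpos : 0 < x i - x j := hc.trans hgt
  refine ⟨AffineMap.lineMap 0 x (c / (x i - x j)), ?_, c / (x i - x j), ⟨by positivity, ?_⟩, rfl⟩
  · rw [mem_diffHyperplane]
    simp only [AffineMap.lineMap_apply, vsub_eq_sub, sub_zero, vadd_eq_add, add_zero,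
      Pi.smul_apply, smul_eq_mul]
    field_simp
  · rw [div_le_one hpos]; exact hgt.le

/-- A ceiling cannot lie inside another hyperplane of differences: if a linear inequality holds on
the facet, it holds on the whole ceiling. -/
theorem IsCeiling.eq_of_facet {n : ℕ} {A : Arrangement n} {R : Set (Fin n → ℝ)}
    {H K : AffineSubspace ℝ (Fin n → ℝ)} (h : IsCeiling A R H)
    (hK : ∀ x ∈ closure R, x ∈ H → x ∈ K) : H ≤ K := by
  rw [← h.2.2.1]
  exact affineSpan_le.2 fun x hx => hK x hx.1 hx.2

/-! ### Shi ceiling diagrams and their parking functions -/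

theorem cox_subset_shi (n : ℕ) : cox n ⊆ shi n := Set.subset_union_left

theorem cox_subset_ish (n : ℕ) [NeZero n] : cox n ⊆ ish n := Set.subset_union_left

/-- The permutation `π` of a Shi region. -/
def shiPerm {n : ℕ} (R : Region (shi n)) : Equiv.Perm (Fin n) :=
  (exists_isOrder (cox_subset_shi n) R).choose

/-- The set partition `Π` of positions, generated by `a ∼ b` whenever `x_{π_a} - x_{π_b} = 1` is a
ceiling of the region. -/
def shiPartition {n : ℕ} (R : Region (shi n)) : Setoid (Fin n) :=
  Relation.EqvGen.setoid fun a b =>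
    IsCeiling (shi n) R.1 (diffHyperplane (shiPerm R a) (shiPerm R b) 1)

/-- A word `w_1 … w_n` with letters in `[n]` whose nondecreasing rearrangement `a_1 ≤ ⋯ ≤ a_n`
satisfies `a_i ≤ i` for all `i`. -/
def IsParking (n : ℕ) (w : Fin n → ℕ) : Prop :=
  (∀ i, w i ∈ Set.Icc 1 n) ∧ ∀ i : Fin n, (w ∘ Tuple.sort w) i ≤ (i : ℕ) + 1

/-- Parking functions of size `n`. -/
def Park (n : ℕ) : Type := {w : Fin n → ℕ // IsParking n w}

/-- `w_i` is the minimal position in the block of `Π` containing the position of `i` in `π`. -/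
def shiWord {n : ℕ} (R : Region (shi n)) (i : Fin n) : ℕ :=
  sInf {b : ℕ | ∃ k : Fin n, b = (k : ℕ) + 1 ∧ shiPartition R k ((shiPerm R).symm i)}

theorem isParking_iff {n : ℕ} (w : Fin n → ℕ) :
    IsParking n w ↔ (∀ i, w i ∈ Set.Icc 1 n) ∧ ∀ k ≤ n, k ≤ #{i | w i ≤ k} := by
  refine and_congr_right fun _ => ?_
  have hcard : ∀ k, #{i | w i ≤ k} = #{i | (w ∘ Tuple.sort w) i ≤ k} := by
    intro k
    refine (Finset.card_bij (fun a _ => Tuple.sort w a) ?_ ?_ ?_).symm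
    · intro a ha
      simpa using ha
    · intro a _ b _ h
      exact (Tuple.sort w).injective h
    · intro b hb
      exact ⟨(Tuple.sort w).symm b, by simpa using hb, by simp⟩
  have hs := Tuple.monotone_sort w
  constructor
  · intro h k hk
    rcases Nat.eq_zero_or_pos k with rfl | hk0
    · exact Nat.zero_le _
    · have h1 := h ⟨k - 1, by omega⟩
      have h2 := (Tuple.lt_card_le_iff_apply_le_of_monotone (a := k)
        (j := (⟨k - 1, by omega⟩ : Fin n)) hs).2 (by simpa [Nat.sub_add_cancel hk0] using h1)
      rw [hcard]
      simp only at h2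
      omega
  · intro h i
    have h1 := h (i + 1) i.2
    rw [hcard] at h1
    exact (Tuple.lt_card_le_iff_apply_le_of_monotone (a := (i : ℕ) + 1) (j := i) hs).1 (by omega)

theorem shiWord_isParking {n : ℕ} (R : Region (shi n)) : IsParking n (shiWord R) := by
  have hle : ∀ i, shiWord R i ≤ ((shiPerm R).symm i : ℕ) + 1 := fun i =>
    Nat.sInf_le ⟨_, rfl, (shiPartition R).refl _⟩
  rw [isParking_iff]
  constructor
  · intro i
    obtain ⟨k, hk, -⟩ := Nat.sInf_mem (s := {b : ℕ | ∃ k : Fin n, b = (k : ℕ) + 1 ∧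
      shiPartition R k ((shiPerm R).symm i)}) ⟨_, _, rfl, (shiPartition R).refl _⟩
    change shiWord R i = _ at hk
    exact ⟨by omega, by omega⟩
  · intro k hk
    calc k = #(univ : Finset (Fin k)) := by simp
      _ ≤ _ := by
        refine Finset.card_le_card_of_injOn (fun a => shiPerm R (Fin.castLE hk a)) ?_ ?_
        · intro a _
          have := hle (shiPerm R (Fin.castLE hk a))
          simp only [Equiv.symm_apply_apply, Fin.val_castLE] at this
          simp only [coe_filter, mem_univ, true_and, Set.mem_ofPred_eq]
          omega
        · intro a _ b _ h
          exact Fin.castLE_injective hk ((shiPerm R).injective h)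

/-- The labelling of Shi regions by parking functions. -/
def shiLabel (n : ℕ) (R : Region (shi n)) : Park n := ⟨shiWord R, shiWord_isParking R⟩

/-! ### Boards and rook placements -/

/-- `P` is a placement of non-attacking rooks on the board `B`. -/
def IsRookPlacement (B P : Finset (ℕ × ℕ)) : Prop :=
  P ⊆ B ∧ ∀ s ∈ P, ∀ t ∈ P, s ≠ t → s.1 ≠ t.1 ∧ s.2 ≠ t.2

/-- Rook placements on `B` that are maximal under inclusion. -/
def MaxRook (B : Finset (ℕ × ℕ)) : Type :=
  {P : Finset (ℕ × ℕ) // Maximal (IsRookPlacement B) P}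

/-- The board `B_n = {(i, j) : 2 ≤ i ≤ n, 1 ≤ j ≤ n + i - 1}`; `i` is the column, `j` the height. -/
def board (n : ℕ) : Finset (ℕ × ℕ) :=
  {s ∈ Icc 2 n ×ˢ Icc 1 (2 * n) | s.2 ≤ n + s.1 - 1}

/-! ### Ish ceiling diagrams and their rook placements -/

/-- `(π, ε)` is the Ish ceiling diagram of `R`: `π` records the order of the coordinates on `R`,
`ε_k = i` if `x_1 - x_{π_k} = i` is a ceiling of `R` (for some `1 ≤ i < π_k`), and `ε_k = 0` if
there is no such ceiling. -/
structure IsIshDiagram {n : ℕ} [NeZero n] (R : Set (Fin n → ℝ)) (π : Equiv.Perm (Fin n))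
    (ε : Fin n → ℕ) : Prop where
  order : IsOrder R π
  dots : ∀ k i : Fin n, i < π k →
    IsCeiling (ish n) R (diffHyperplane 0 (π k) ((i : ℝ) + 1)) → ε k = (i : ℕ) + 1
  noDots : ∀ k : Fin n, (∀ i : Fin n, i < π k →
    ¬ IsCeiling (ish n) R (diffHyperplane 0 (π k) ((i : ℝ) + 1))) → ε k = 0

theorem ish_ceiling_unique {n : ℕ} [NeZero n] (R : Region (ish n)) {i i' j : Fin n}
    (hij : i < j) (h : IsCeiling (ish n) R.1 (diffHyperplane 0 j ((i : ℝ) + 1)))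
    (h' : IsCeiling (ish n) R.1 (diffHyperplane 0 j ((i' : ℝ) + 1))) : i' ≤ i := by
  by_contra hlt
  have hj : (0 : Fin n) ≠ j := fun h0 => by subst h0; exact absurd hij (Fin.not_lt_zero i)
  have hlt' : (i : ℝ) < (i' : ℝ) := by exact_mod_cast not_le.1 hlt
  have hcl : ∀ x ∈ closure R.1, x 0 - x j ≤ (i : ℝ) + 1 := by
    refine closure_minimal (fun x hx => (h.sub_lt (by positivity) hx).le) ?_
    exact isClosed_le (f := fun x : Fin n → ℝ => x 0 - x j) (g := fun _ => (i : ℝ) + 1)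
      (by fun_prop) (by fun_prop)
  have hle : diffHyperplane 0 j ((i' : ℝ) + 1) ≤ ⊥ := by
    refine h'.eq_of_facet fun x hx hxH => ?_
    rw [mem_diffHyperplane] at hxH
    have := hcl x hx
    exact absurd hxH (by intro h2; linarith)
  have hm : (Pi.single 0 ((i' : ℝ) + 1) : Fin n → ℝ) ∈ diffHyperplane 0 j ((i' : ℝ) + 1) := by
    rw [mem_diffHyperplane]
    simp [Pi.single_eq_of_ne hj.symm]
  exact AffineSubspace.notMem_bot ℝ _ _ (hle hm)

theorem exists_isIshDiagram {n : ℕ} [NeZero n] (R : Region (ish n)) :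
    ∃! p : Equiv.Perm (Fin n) × (Fin n → ℕ), IsIshDiagram R.1 p.1 p.2 := by
  classical
  obtain ⟨π, hπ, hu⟩ := exists_isOrder (cox_subset_ish n) R
  let C : Fin n → Fin n → Prop := fun k i =>
    i < π k ∧ IsCeiling (ish n) R.1 (diffHyperplane 0 (π k) ((i : ℝ) + 1))
  have hC : ∀ k i i', C k i → C k i' → i = i' := fun k i i' h h' =>
    le_antisymm (ish_ceiling_unique R h'.1 h'.2 h.2) (ish_ceiling_unique R h.1 h.2 h'.2)
  refine ⟨(π, fun k => if h : ∃ i, C k i then (h.choose : ℕ) + 1 else 0), ⟨hπ, ?_, ?_⟩, ?_⟩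
  · intro k i hi hc
    have h : ∃ i, C k i := ⟨i, hi, hc⟩
    simp only [dif_pos h, hC k _ _ h.choose_spec ⟨hi, hc⟩]
  · intro k hk
    have h : ¬ ∃ i, C k i := fun ⟨i, hi, hc⟩ => hk i hi hc
    simp only [dif_neg h]
  · rintro ⟨σ, ε⟩ hσ
    obtain rfl : σ = π := hu σ hσ.order
    refine Prod.ext rfl (funext fun k => ?_)
    by_cases h : ∃ i, C k i
    · simp only [dif_pos h]
      exact hσ.dots k _ h.choose_spec.1 h.choose_spec.2
    · simp only [dif_neg h]
      exact hσ.noDots k fun i hi hc => h ⟨i, hi, hc⟩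

/-- The permutation `π` of the Ish ceiling diagram of `R`. -/
def ishPerm {n : ℕ} [NeZero n] (R : Region (ish n)) : Equiv.Perm (Fin n) :=
  (exists_isIshDiagram R).choose.1

/-- The dot sequence `ε` of the Ish ceiling diagram of `R`. -/
def ishDots {n : ℕ} [NeZero n] (R : Region (ish n)) : Fin n → ℕ :=
  (exists_isIshDiagram R).choose.2

theorem isIshDiagram {n : ℕ} [NeZero n] (R : Region (ish n)) :
    IsIshDiagram R.1 (ishPerm R) (ishDots R) :=
  (exists_isIshDiagram R).choose_spec.1

/-- The height of the rook in the column of the letter `i`: the position of `i` in `π` if there are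
no dots over `i`, and `n` plus the number of dots over `i` otherwise. -/
def rookHeight {n : ℕ} [NeZero n] (R : Region (ish n)) (i : Fin n) : ℕ :=
  if ishDots R ((ishPerm R).symm i) = 0 then ((ishPerm R).symm i : ℕ) + 1
  else n + ishDots R ((ishPerm R).symm i)

/-- The placement with one rook in each of the columns `1, …, n`. -/
def rhoHat {n : ℕ} [NeZero n] (R : Region (ish n)) : Finset (ℕ × ℕ) :=
  univ.image fun i : Fin n => ((i : ℕ) + 1, rookHeight R i)

theorem ishDots_spec {n : ℕ} [NeZero n] (R : Region (ish n)) (k : Fin n)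
    (hk : ishDots R k ≠ 0) : ∃ i : Fin n, i < ishPerm R k ∧ ishDots R k = (i : ℕ) + 1 ∧
      IsCeiling (ish n) R.1 (diffHyperplane 0 (ishPerm R k) ((i : ℝ) + 1)) := by
  by_contra hne
  refine hk ((isIshDiagram R).noDots k fun i hi hc => hne ⟨i, hi, ?_, hc⟩)
  exact (isIshDiagram R).dots k i hi hc

theorem ishDots_inj {n : ℕ} [NeZero n] (R : Region (ish n)) {a b : Fin n}
    (ha : ishDots R a ≠ 0) (hab : ishDots R a = ishDots R b) : a = b := by
  wlog hlt : a < b generalizing a b with H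
  · rcases lt_trichotomy a b with h | h | h
    · exact absurd h hlt
    · exact h
    · exact (H (hab ▸ ha) hab.symm h).symm
  exfalso
  obtain ⟨i, hi, hia, hci⟩ := ishDots_spec R a ha
  obtain ⟨i', hi', hib, hci'⟩ := ishDots_spec R b (hab ▸ ha)
  obtain rfl : i = i' := Fin.ext (by omega)
  have hne : ishPerm R a ≠ ishPerm R b := fun h => hlt.ne ((ishPerm R).injective h)
  have h0 : (0 : Fin n) ≠ ishPerm R a := fun h => by
    rw [← h] at hi; exact absurd hi (Fin.not_lt_zero i)
  have hcl : ∀ x ∈ closure R.1, x 0 - x (ishPerm R b) ≤ (i : ℝ) + 1 ∧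
      x (ishPerm R b) ≤ x (ishPerm R a) := by
    refine closure_minimal (fun x hx => ⟨(hci'.sub_lt (by positivity) hx).le,
      ((isIshDiagram R).order x hx a b hlt).le⟩) ?_
    exact (isClosed_le (f := fun x : Fin n → ℝ => x 0 - x (ishPerm R b))
      (g := fun _ => (i : ℝ) + 1) (by fun_prop) (by fun_prop)).inter
      (isClosed_le (f := fun x : Fin n → ℝ => x (ishPerm R b))
        (g := fun x => x (ishPerm R a)) (by fun_prop) (by fun_prop))
  have hle : diffHyperplane 0 (ishPerm R a) ((i : ℝ) + 1) ≤
      diffHyperplane (ishPerm R b) (ishPerm R a) 0 := by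
    refine hci.eq_of_facet fun x hx hxH => ?_
    rw [mem_diffHyperplane] at hxH ⊢
    obtain ⟨h1, h2⟩ := hcl x hx
    linarith
  have hm : (Pi.single (ishPerm R a) (-((i : ℝ) + 1)) : Fin n → ℝ) ∈
      diffHyperplane 0 (ishPerm R a) ((i : ℝ) + 1) := by
    rw [mem_diffHyperplane]
    simp [Pi.single_eq_of_ne h0]
  have h3 := hle hm
  rw [mem_diffHyperplane, Pi.single_eq_same, Pi.single_eq_of_ne hne.symm] at h3
  have : (0 : ℝ) ≤ (i : ℝ) := by positivity
  linarith

theorem rookHeight_inj {n : ℕ} [NeZero n] (R : Region (ish n)) {i j : Fin n}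
    (h : rookHeight R i = rookHeight R j) : i = j := by
  unfold rookHeight at h
  split_ifs at h with h1 h2 h2
  · exact (ishPerm R).symm.injective (Fin.ext (by omega))
  · omega
  · omega
  · exact (ishPerm R).symm.injective (ishDots_inj R h1 (by omega))

theorem mem_board {n : ℕ} {s : ℕ × ℕ} :
    s ∈ board n ↔ 2 ≤ s.1 ∧ s.1 ≤ n ∧ 1 ≤ s.2 ∧ s.2 ≤ n + s.1 - 1 := by
  simp only [board, mem_filter, mem_product, mem_Icc]
  omega

theorem mem_board_rook {n : ℕ} [NeZero n] (R : Region (ish n)) (i : Fin n) (hi : 1 ≤ (i : ℕ)) :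
    ((i : ℕ) + 1, rookHeight R i) ∈ board n := by
  rw [mem_board]
  refine ⟨by simpa using hi, by simp, ?_⟩
  simp only [rookHeight]
  split_ifs with h
  · omega
  · obtain ⟨j, hj, hd, -⟩ := ishDots_spec R _ h
    rw [Equiv.apply_symm_apply] at hj
    have : (j : ℕ) < i := hj
    omega

theorem rho_maximal {n : ℕ} [NeZero n] (R : Region (ish n)) :
    Maximal (IsRookPlacement (board n)) (rhoHat R ∩ board n) := by
  refine ⟨⟨inter_subset_right, ?_⟩, ?_⟩
  · intro s hs t ht hst
    simp only [mem_inter, rhoHat, mem_image, mem_univ, true_and] at hs ht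
    obtain ⟨⟨i, rfl⟩, -⟩ := hs
    obtain ⟨⟨j, rfl⟩, -⟩ := ht
    have hij : i ≠ j := fun h => hst (by rw [h])
    refine ⟨fun h => hij (Fin.ext (by simpa using h)), fun h => hij (rookHeight_inj R h)⟩
  · intro Q hQ hle s hs
    have hsB := hQ.1 hs
    have hb := mem_board.1 hsB
    have hlt : s.1 - 1 < n := by omega
    have hr := mem_board_rook R ⟨s.1 - 1, hlt⟩ (by simp only; omega)
    have hmem : ((s.1 - 1 + 1, rookHeight R ⟨s.1 - 1, hlt⟩) : ℕ × ℕ) ∈ rhoHat R ∩ board n :=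
      mem_inter.2 ⟨mem_image.2 ⟨⟨s.1 - 1, hlt⟩, mem_univ _, rfl⟩, hr⟩
    by_contra hns
    have := hQ.2 s hs _ (hle hmem) (fun h => hns (h ▸ hmem))
    exact this.1 (by simp only; omega)

/-- The map `ρ`: the restriction of the placement `rhoHat R` to `B_n`. -/
def rho (n : ℕ) [NeZero n] (R : Region (ish n)) : MaxRook (board n) :=
  ⟨rhoHat R ∩ board n, rho_maximal R⟩

/-! ### The action of the cyclic group on words, and the Cycle Lemma -/

/-- Two words lie in the same orbit of the action of `ℤ/(n+1)` that adds `1` to every letter,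
letters being read modulo `n + 1`. -/
def SameOrbit (n : ℕ) (v w : Fin n → ℕ) : Prop :=
  ∃ c : ℕ, ∀ i, w i ≡ v i + c [MOD n + 1]

theorem parking_unique {n : ℕ} {v w w' : Fin n → ℕ} (hw : IsParking n w) (hw' : IsParking n w')
    (h : SameOrbit n v w) (h' : SameOrbit n v w') : w = w' := by
  rw [isParking_iff] at hw hw'
  obtain ⟨c, hc⟩ := h
  obtain ⟨c', hc'⟩ := h'
  obtain ⟨d, hd, hdw⟩ : ∃ d ≤ n, ∀ i, w' i ≡ w i + d [MOD n + 1] := by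
    refine ⟨(c' + n * c) % (n + 1), Nat.le_of_lt_succ (Nat.mod_lt _ n.succ_pos), ?_⟩
    intro i
    have h1 : w i + (c' + n * c) % (n + 1) ≡ v i + c + (c' + n * c) [MOD n + 1] :=
      (hc i).add (Nat.mod_modEq _ _)
    have h2 : v i + c + (c' + n * c) ≡ v i + c' [MOD n + 1] := by
      have : v i + c + (c' + n * c) = v i + c' + (n + 1) * c := by ring
      rw [this]
      simp [Nat.ModEq]
    exact (hc' i).trans (h1.trans h2).symm
  have hcase : ∀ i, w' i = w i + d ∨ w' i + (n + 1) = w i + d := by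
    intro i
    have h1 := hw.1 i
    have h2 := hw'.1 i
    rw [Set.mem_Icc] at h1 h2
    have h3 := hdw i
    unfold Nat.ModEq at h3
    rw [Nat.mod_eq_of_lt (by omega)] at h3
    rcases lt_or_ge (w i + d) (n + 1) with h4 | h4
    · rw [Nat.mod_eq_of_lt h4] at h3
      exact Or.inl h3
    · rw [Nat.mod_eq_sub_mod h4, Nat.mod_eq_of_lt (by omega)] at h3
      right
      omega
  rcases Nat.eq_zero_or_pos d with rfl | hd0
  · funext i
    have h1 := hw.1 i
    have h2 := hw'.1 i
    rw [Set.mem_Icc] at h1 h2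
    rcases hcase i with h | h <;> omega
  · exfalso
    have h1 := hw'.2 d hd
    have h2 := hw.2 (n + 1 - d) (by omega)
    have hdisj : Disjoint ({i | w' i ≤ d} : Finset (Fin n))
        ({i | w i ≤ n + 1 - d} : Finset (Fin n)) := by
      rw [Finset.disjoint_filter]
      intro i _ ha hb
      have h3 := hw.1 i
      have h4 := hw'.1 i
      rw [Set.mem_Icc] at h3 h4
      rcases hcase i with h | h <;> omega
    have h3 := Finset.card_le_univ (({i | w' i ≤ d} : Finset (Fin n)) ∪
      ({i | w i ≤ n + 1 - d} : Finset (Fin n)))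
    rw [Finset.card_union_of_disjoint hdisj, Fintype.card_fin] at h3
    omega

theorem parking_exists {n : ℕ} (v : Fin n → ℕ) : ∃ w, IsParking n w ∧ SameOrbit n v w := by
  classical
  let c : ℕ → ℤ := fun t => #{i | v i % (n + 1) = t % (n + 1)}
  let F : ℕ → ℤ := fun t => (∑ j ∈ range t, c j) - t
  let G : ℕ → ℤ := fun t => F t * (n + 1) + t
  have hper : ∀ t, c (t + (n + 1)) = c t := fun t => by simp [c]
  have hsum : ∑ j ∈ range (n + 1), c j = n := by
    have h := Finset.card_eq_sum_card_fiberwise (s := (univ : Finset (Fin n)))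
      (t := range (n + 1)) (f := fun i => v i % (n + 1))
      (fun i _ => by simpa using Nat.mod_lt (v i) n.succ_pos)
    rw [card_univ, Fintype.card_fin] at h
    have h' : (n : ℤ) = ∑ j ∈ range (n + 1), (#{i | v i % (n + 1) = j} : ℤ) := by
      exact_mod_cast h
    rw [h']
    refine Finset.sum_congr rfl fun j hj => ?_
    simp only [c]
    rw [Nat.mod_eq_of_lt (a := j) (mem_range.1 hj)]
  have hF : ∀ t, F (t + (n + 1)) = F t - 1 := by
    intro t
    have : ∑ j ∈ range (t + (n + 1)), c j = ∑ j ∈ range t, c j + n := by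
      rw [add_comm t, Finset.sum_range_add, hsum, add_comm]
      congr 1
      refine Finset.sum_congr rfl fun j _ => ?_
      rw [add_comm, hper]
    simp only [F, this]
    push_cast
    ring
  have hG : ∀ t, G (t + (n + 1)) = G t := by
    intro t
    simp only [G, hF]
    push_cast
    ring
  obtain ⟨t₀, -, hmin⟩ := Finset.exists_min_image (range (n + 1)) G ⟨0, by simp⟩
  have hmin' : ∀ t, G t₀ ≤ G t := by
    intro t
    have h : G t = G (t % (n + 1)) := by
      have h1 : ∀ q r, G (r + (n + 1) * q) = G r := by
        intro q r
        induction q with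
        | zero => simp
        | succ q ih => rw [← ih, Nat.mul_succ, ← add_assoc, hG]
      conv_lhs => rw [← Nat.mod_add_div t (n + 1)]
      exact h1 _ _
    rw [h]
    exact hmin _ (by simpa using Nat.mod_lt t n.succ_pos)
  have hFmin : ∀ m ≤ n, F t₀ ≤ F (t₀ + m) := by
    intro m hm
    have h1 := hmin' (t₀ + m)
    simp only [G] at h1
    push_cast at h1
    by_contra hlt
    have h2 : F (t₀ + m) + 1 ≤ F t₀ := by omega
    have h3 : (m : ℤ) ≤ n := by exact_mod_cast hm
    nlinarith
  let u : Fin n → ℕ := fun i => (v i + n * t₀) % (n + 1)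
  have hu : ∀ j ≤ n, (#{i | u i = j} : ℤ) = c (t₀ + j) := by
    intro j hj
    simp only [c]
    congr 2
    refine Finset.filter_congr fun i _ => ?_
    have e1 : u i = j ↔ v i + n * t₀ ≡ j [MOD n + 1] := by
      simp only [u, Nat.ModEq]
      rw [Nat.mod_eq_of_lt (a := j) (by omega)]
    rw [e1]
    change _ ↔ v i ≡ t₀ + j [MOD n + 1]
    have e2 : n * t₀ + t₀ ≡ 0 [MOD n + 1] := by
      have : n * t₀ + t₀ = (n + 1) * t₀ := by ring
      rw [this]
      simp [Nat.ModEq]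
    constructor
    · intro h
      have h1 : v i + (n * t₀ + t₀) ≡ t₀ + j [MOD n + 1] := by
        have := h.add_right t₀
        rwa [add_assoc, add_comm j] at this
      exact ((e2.add_left (v i)).symm.trans h1 : v i + 0 ≡ _ [MOD n + 1])
    · intro h
      have h1 := h.add_right (n * t₀)
      have h2 : t₀ + j + n * t₀ = j + (n * t₀ + t₀) := by ring
      rw [h2] at h1
      exact h1.trans (e2.add_left j)
  have hcount : ∀ k ≤ n, k ≤ #{i | u i < k} := by
    intro k hk
    have h := Finset.card_eq_sum_card_fiberwise (s := ({i | u i < k} : Finset (Fin n)))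
      (t := range k) (f := u) (fun i hi => by simpa using hi)
    have h2 : (#{i | u i < k} : ℤ) = ∑ j ∈ range k, c (t₀ + j) := by
      rw [h]
      push_cast
      refine Finset.sum_congr rfl fun j hj => ?_
      have hjk := mem_range.1 hj
      rw [← hu j (by omega), Finset.filter_filter]
      congr 2
      refine Finset.filter_congr fun i _ => ?_
      constructor
      · exact fun h => h.2
      · exact fun h => ⟨h ▸ hjk, h⟩
    have h3 := hFmin k hk
    simp only [F, Finset.sum_range_add] at h3
    push_cast at h3
    omega
  have hall : ∀ i, u i < n := by
    have h1 := hcount n le_rfl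
    have h2 : ({i | u i < n} : Finset (Fin n)) = univ :=
      Finset.eq_univ_of_card _ (le_antisymm (Finset.card_le_univ _) (by simpa using h1))
    intro i
    have := Finset.mem_univ i
    rw [← h2] at this
    simpa using this
  refine ⟨fun i => u i + 1, ?_, n * t₀ + 1, fun i => ?_⟩
  · rw [isParking_iff]
    refine ⟨fun i => ⟨by omega, hall i⟩, fun k hk => ?_⟩
    simpa [Nat.succ_le_iff] using hcount k hk
  · rw [← add_assoc]
    exact (Nat.mod_modEq _ _).add_right 1

/-- Every orbit contains exactly one parking function. -/
theorem cycle_lemma {n : ℕ} (v : Fin n → ℕ) : ∃! w, IsParking n w ∧ SameOrbit n v w := by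
  obtain ⟨w, hw⟩ := parking_exists v
  exact ⟨w, hw, fun w' hw' => parking_unique hw'.1 hw.1 hw'.2 hw.2⟩

/-! ### Horizontal lasers and the map `α` -/

/-- The square `s` contains laser fire: it lies strictly to the right of a rook of `P`, in the row
of that rook. -/
def HasLaser (P : Finset (ℕ × ℕ)) (s : ℕ × ℕ) : Prop :=
  ∃ r ∈ P, r.1 < s.1 ∧ r.2 = s.2

open Classical in
/-- The word `v_1 … v_n` of a rook placement on `B_n`: `v_1 = 1`, and for `i ≥ 2`, `v_i` is the
number of squares of `B_n` weakly below the rook in column `i` that contain no laser fire. -/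
def laserWord {n : ℕ} (P : Finset (ℕ × ℕ)) (i : Fin n) : ℕ :=
  if (i : ℕ) = 0 then 1
  else #{s ∈ board n | s.1 = (i : ℕ) + 1 ∧ (∃ r ∈ P, r.1 = s.1 ∧ s.2 ≤ r.2) ∧ ¬ HasLaser P s}

/-- The map `α`: the unique parking function in the orbit of `v_1 … v_n`. -/
def alpha (n : ℕ) (P : MaxRook (board n)) : Park n :=
  ⟨(cycle_lemma (laserWord P.1)).choose, (cycle_lemma (laserWord P.1)).choose_spec.1.1⟩

end

end ShiIsh

namespace ShiIsh

noncomputable section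

open Finset

/-! ### Regions as sign classes -/

/-! Each of `rho`, `alpha` and `shiLabel` is shown to be injective and surjective, without counting
regions; ω is then the inverse of `shiLabel`.

A region is determined by its sides of the hyperplanes (`Region.mem_of_sameSide`), and a wall `x_i -
x_j = c` with `c > 0` is a ceiling if some point is cut off from the region by that wall alone
(`isCeiling_of_adjacent`). Ceilings thereby become inequalities that can be tested at any single
point (`ish_isCeiling_iff`, `shi_isCeiling_iff`).

For Ish, the order of the coordinates and the dots determine the region (`ish_sub_lt_iff`). Rook
heights reveal all dots and the positions of the undotted letters other than 1. The letter 1 and the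
dotted letters stand in increasing order of dots (`position_lt_of_letterDots_lt`), so they fill the
remaining positions in exactly one way. Conversely, `exists_ish_region` writes down a point
realizing any such diagram.

For `alpha`, the lasers of the earlier columns leave exactly `n + 1` free squares in each column `c`
(`card_freeRows`). Choosing rooks column by column is thus the same as choosing `v_2, …, v_n` freely
in `[n+1]`, and the words with `v_1 = 1` form a transversal of the orbits.

For Shi, the ceilings are the maximal close pairs. They link the positions into chains along which
both position and letter increase, so in the word they are the pairs of consecutive equal letters,
and they do not nest (`IsShiOrder`). Non-nesting lets the permutation be rebuilt position by
position (`IsShiOrder.eq`), and the ceilings then give the region. For existence, the occurrences of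
each letter of a parking function are placed on a time line at unit distances, with starting times
chosen to give the first occurrences the prescribed ranks (`exists_starting_times`). The resulting
order and arcs are realized by a unit interval representation (`exists_shi_point`). -/

/-- `x` and `y` lie strictly on the same side of the hyperplane `x_i - x_j = c`. -/
def SameSide {n : ℕ} (x y : Fin n → ℝ) (i j : Fin n) (c : ℝ) : Prop :=
  (x i - x j < c ∧ y i - y j < c) ∨ (c < x i - x j ∧ c < y i - y j)

theorem SameSide.of_lt_iff {n : ℕ} {x y : Fin n → ℝ} {i j : Fin n} {c : ℝ}
    (hx : x i - x j ≠ c) (hy : y i - y j ≠ c) (h : x i - x j < c ↔ y i - y j < c) :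
    SameSide x y i j c := by
  rcases lt_or_gt_of_ne hx with h1 | h1
  · exact Or.inl ⟨h1, h.1 h1⟩
  · refine Or.inr ⟨h1, lt_of_le_of_ne (not_lt.1 fun h2 => ?_) hy.symm⟩
    exact lt_asymm h1 (h.2 h2)

theorem SameSide.lineMap {n : ℕ} {x y : Fin n → ℝ} {i j : Fin n} {c : ℝ}
    (h : SameSide x y i j c) {t : ℝ} (ht : t ∈ Set.Icc (0 : ℝ) 1) :
    SameSide x (AffineMap.lineMap x y t) i j c := by
  have e : (AffineMap.lineMap x y t : Fin n → ℝ) i - (AffineMap.lineMap x y t : Fin n → ℝ) j =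
      (1 - t) * (x i - x j) + t * (y i - y j) := by
    simp only [AffineMap.lineMap_apply_module, Pi.add_apply, Pi.smul_apply, smul_eq_mul]
    ring
  obtain ⟨h0, h1⟩ := ht
  have h1' : 0 ≤ 1 - t := by linarith
  unfold SameSide
  rw [e]
  rcases h with ⟨ha, hb⟩ | ⟨ha, hb⟩
  · refine Or.inl ⟨ha, ?_⟩
    rcases h0.eq_or_lt with rfl | h0
    · simpa using ha
    · nlinarith
  · refine Or.inr ⟨ha, ?_⟩
    rcases h0.eq_or_lt with rfl | h0
    · simpa using ha
    · nlinarith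

/-- The segment from `x` to `y` crosses no hyperplane, so it stays inside one connected component.
-/
theorem Region.mem_of_sameSide {n : ℕ} {A : Arrangement n} (R : Region A) {x y : Fin n → ℝ}
    (hx : x ∈ R.1)
    (h : ∀ H ∈ A, ∃ i j c, H = diffHyperplane i j c ∧ SameSide x y i j c) : y ∈ R.1 := by
  have hxR : x ∈ complement A := R.subset hx
  have hR : R.1 = connectedComponentIn (complement A) x := by
    obtain ⟨R, z, hz, rfl⟩ := R
    exact connectedComponentIn_eq hx
  rw [hR]
  have hseg : segment ℝ x y ⊆ complement A := by
    intro p hp H hH hpH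
    rw [segment_eq_image_lineMap] at hp
    obtain ⟨t, ht, rfl⟩ := hp
    obtain ⟨i, j, c, rfl, hs⟩ := h H hH
    rw [mem_diffHyperplane] at hpH
    rcases hs.lineMap ht with ⟨-, h1⟩ | ⟨-, h1⟩ <;> linarith
  exact (convex_segment x y).isPreconnected.subset_connectedComponentIn
    (left_mem_segment ℝ x y) hseg (right_mem_segment ℝ x y)

theorem Region.eq_of_mem {n : ℕ} {A : Arrangement n} {R R' : Region A} {x : Fin n → ℝ}
    (hx : x ∈ R.1) (hx' : x ∈ R'.1) : R = R' := by
  obtain ⟨R, z, hz, rfl⟩ := R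
  obtain ⟨R', z', hz', rfl⟩ := R'
  exact Subtype.ext ((connectedComponentIn_eq hx).trans (connectedComponentIn_eq hx').symm)

theorem exists_region_of_mem {n : ℕ} {A : Arrangement n} {x : Fin n → ℝ}
    (hx : x ∈ complement A) : ∃ R : Region A, x ∈ R.1 :=
  ⟨⟨_, x, hx, rfl⟩, mem_connectedComponentIn hx⟩

/-- A hyperplane `x_i - x_j = c` with `c > 0` is a ceiling of the region of `x` as soon as it is
the only hyperplane separating `x` from some point. -/
theorem isCeiling_of_adjacent {n : ℕ} {A : Arrangement n} (hfin : A.Finite) (R : Region A)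
    {i j : Fin n} {c : ℝ} (hc : 0 < c) (hH : diffHyperplane i j c ∈ A) {x x' : Fin n → ℝ}
    (hx : x ∈ R.1) (hlt : x i - x j < c) (hgt : c < x' i - x' j)
    (h : ∀ K ∈ A, K ≠ diffHyperplane i j c →
      ∃ a b d, K = diffHyperplane a b d ∧ SameSide x x' a b d) :
    IsCeiling A R.1 (diffHyperplane i j c) := by
  have : Nonempty (Fin n) := ⟨i⟩
  choose! a b d hK hs using h
  -- `U` is the open cell that remains when the wall under test is removed; finiteness of the
  -- arrangement makes it open.
  let U : Set (Fin n → ℝ) := ⋂ K ∈ A \ {diffHyperplane i j c},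
    {z | SameSide x z (a K) (b K) (d K)}
  have hUmem : ∀ z, z ∈ U ↔ ∀ K ∈ A, K ≠ diffHyperplane i j c →
      SameSide x z (a K) (b K) (d K) := by
    intro z
    simp [U]
  have hUo : IsOpen U := by
    refine (hfin.subset Set.sdiff_subset).isOpen_biInter fun K _ => ?_
    have h1 : Continuous fun z : Fin n → ℝ => z (a K) - z (b K) := by fun_prop
    exact (isOpen_const.inter (isOpen_lt h1 continuous_const)).union
      (isOpen_const.inter (isOpen_lt continuous_const h1))
  have hUR : ∀ q ∈ U, q i - q j < c → q ∈ R.1 := by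
    intro q hq hqc
    refine R.mem_of_sameSide hx fun K hKA => ?_
    by_cases hKH : K = diffHyperplane i j c
    · exact ⟨i, j, c, hKH, Or.inl ⟨hlt, hqc⟩⟩
    · exact ⟨_, _, _, hK K hKA hKH, (hUmem q).1 hq K hKA hKH⟩
  have hlm : ∀ (p q : Fin n → ℝ) (t : ℝ), (AffineMap.lineMap p q t : Fin n → ℝ) i -
      (AffineMap.lineMap p q t : Fin n → ℝ) j = (1 - t) * (p i - p j) + t * (q i - q j) := by
    intro p q t
    simp only [AffineMap.lineMap_apply_module, Pi.add_apply, Pi.smul_apply, smul_eq_mul]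
    ring
  have hcl : ∀ q ∈ U, q ∈ diffHyperplane i j c → q ∈ closure R.1 := by
    intro q hqU hqH
    rw [mem_diffHyperplane] at hqH
    have hcont : Continuous fun t : ℝ => (AffineMap.lineMap q x t : Fin n → ℝ) :=
      AffineMap.lineMap_continuous
    have ht : Filter.Tendsto (fun t : ℝ => (AffineMap.lineMap q x t : Fin n → ℝ))
        (nhdsWithin 0 (Set.Ioi 0)) (nhds q) := by
      have := hcont.tendsto 0
      rw [AffineMap.lineMap_apply_zero] at this
      exact this.mono_left nhdsWithin_le_nhds
    refine mem_closure_of_tendsto ht ?_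
    filter_upwards [ht.eventually (hUo.mem_nhds hqU), self_mem_nhdsWithin] with t htU ht0
    refine hUR _ htU ?_
    have ht0' : (0 : ℝ) < t := ht0
    rw [hlm, hqH]
    nlinarith
  -- The segment from `x` to `x'` meets the wall at a point of `U`, which will be interior to the
  -- facet.
  obtain ⟨z, hzU, hzH⟩ : ∃ z ∈ U, z ∈ diffHyperplane i j c := by
    have hpos : 0 < (x' i - x' j) - (x i - x j) := by linarith
    refine ⟨AffineMap.lineMap x x' ((c - (x i - x j)) / ((x' i - x' j) - (x i - x j))), ?_, ?_⟩
    · rw [hUmem]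
      intro K hKA hKH
      refine (hs K hKA hKH).lineMap ⟨div_nonneg (by linarith) hpos.le, ?_⟩
      rw [div_le_one hpos]
      linarith
    · rw [mem_diffHyperplane, hlm]
      field_simp
      ring
  refine ⟨hH, ?_, ?_, ?_⟩
  · rw [mem_diffHyperplane]
    simpa using hc.ne
  · refine le_antisymm (affineSpan_le.2 Set.inter_subset_right) ?_
    intro q hq
    have hcont : Continuous fun t : ℝ => (AffineMap.lineMap z q t : Fin n → ℝ) :=
      AffineMap.lineMap_continuous
    have ht : Filter.Tendsto (fun t : ℝ => (AffineMap.lineMap z q t : Fin n → ℝ))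
        (nhdsWithin 0 (Set.Ioi 0)) (nhds z) := by
      have := hcont.tendsto 0
      rw [AffineMap.lineMap_apply_zero] at this
      exact this.mono_left nhdsWithin_le_nhds
    -- Any `q` on the wall lies on the line through `z` and a nearby point of the facet, so the
    -- facet spans the wall.
    obtain ⟨t, htU, ht0⟩ := ((ht.eventually (hUo.mem_nhds hzU)).and self_mem_nhdsWithin).exists
    have ht0' : (t : ℝ) ≠ 0 := ne_of_gt ht0
    have h1 : (AffineMap.lineMap z q t : Fin n → ℝ) ∈ diffHyperplane i j c :=
      AffineMap.lineMap_mem t hzH hq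
    have h2 : q = AffineMap.lineMap z (AffineMap.lineMap z q t : Fin n → ℝ) (1 / t) := by
      rw [AffineMap.lineMap_lineMap_right, one_div_mul_cancel ht0', AffineMap.lineMap_apply_one]
    rw [h2]
    exact AffineMap.lineMap_mem _ (subset_affineSpan ℝ _ ⟨hcl z hzU hzH, hzH⟩)
      (subset_affineSpan ℝ _ ⟨hcl _ htU h1, h1⟩)
  · intro y hy hopp
    have hyc : y i - y j < c := R.lt_of_lt hH hx hy hlt
    -- Opposite sides would give `s * (y i - y j) = c` with `0 ≤ s ≤ 1`, although `y i - y j < c`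
    -- and `0 < c`.
    obtain ⟨p, hp, s, ⟨hs0, hs1⟩, rfl⟩ := AffineSubspace.wOppSide_iff_exists_wbtw.1 hopp.1
    rw [mem_diffHyperplane, hlm] at hp
    simp only [Pi.zero_apply, sub_zero, mul_zero, zero_add] at hp
    rcases le_total (y i - y j) 0 with h0 | h0
    · linarith [mul_nonpos_of_nonneg_of_nonpos hs0 h0]
    · linarith [mul_le_of_le_one_left h0 hs1]

theorem IsOrder.sub_pos_iff {n : ℕ} {R : Set (Fin n → ℝ)} {π : Equiv.Perm (Fin n)}
    (h : IsOrder R π) {x : Fin n → ℝ} (hx : x ∈ R) (i j : Fin n) :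
    x j < x i ↔ π.symm i < π.symm j := by
  have key : ∀ i j : Fin n, π.symm i < π.symm j → x j < x i := fun i j hij => by
    simpa using h x hx _ _ hij
  refine ⟨fun hij => ?_, key i j⟩
  by_contra hne
  rcases (not_lt.1 hne).eq_or_lt with he | hlt
  · rw [π.symm.injective he] at hij
    exact lt_irrefl _ hij
  · exact lt_asymm hij (key _ _ hlt)

theorem closure_sub_le {n : ℕ} {R : Set (Fin n → ℝ)} {i j : Fin n} {c : ℝ}
    (h : ∀ x ∈ R, x i - x j ≤ c) {x : Fin n → ℝ} (hx : x ∈ closure R) : x i - x j ≤ c := by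
  have hcl : IsClosed {x : Fin n → ℝ | x i - x j ≤ c} :=
    isClosed_le (by fun_prop) (by fun_prop)
  exact closure_minimal (fun y hy => h y hy) hcl hx

/-- Evaluating on explicit points of the smaller hyperplane pins down the equation of the larger one
up to sign. This rules out unwanted coincidences on a facet. -/
theorem diffHyperplane_le {n : ℕ} {i j a b : Fin n} {c d : ℝ} (hij : i ≠ j)
    (h : diffHyperplane i j c ≤ diffHyperplane a b d) :
    (a = b ∧ d = 0) ∨ (a = i ∧ b = j ∧ d = c) ∨ (a = j ∧ b = i ∧ d = -c) := by
  have h1 : ∀ x : Fin n → ℝ, x i - x j = c → x a - x b = d := fun x hx => h hx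
  by_cases hab : a = b
  · left
    have := h1 (Pi.single i c) (by simp [Pi.single_eq_of_ne hij.symm])
    subst hab
    simp at this
    exact ⟨rfl, this.symm⟩
  right
  have e : ∀ s : ℝ, Pi.single (M := fun _ => ℝ) i (c + s) a + Pi.single (M := fun _ => ℝ) j s a -
      (Pi.single (M := fun _ => ℝ) i (c + s) b + Pi.single (M := fun _ => ℝ) j s b) = d := by
    intro s
    refine h1 (fun k => Pi.single (M := fun _ => ℝ) i (c + s) k +
      Pi.single (M := fun _ => ℝ) j s k) ?_
    simp [Pi.single_eq_of_ne hij.symm, Pi.single_eq_of_ne hij]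
  have e0 := e 0
  have e1 := e 1
  -- Coordinate `k` can be moved freely within the smaller hyperplane, so it cannot occur in the
  -- larger equation.
  have e3 : ∀ k : Fin n, k ≠ i → k ≠ j → k ≠ a ∧ k ≠ b := by
    intro k hki hkj
    have q0 := h1 (Pi.single i c) (by simp [Pi.single_eq_of_ne hij.symm])
    have q1 := h1 (fun l => Pi.single (M := fun _ => ℝ) i c l +
      Pi.single (M := fun _ => ℝ) k 1 l)
      (by simp [Pi.single_eq_of_ne hij.symm, Pi.single_eq_of_ne hki.symm,
        Pi.single_eq_of_ne hkj.symm])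
    constructor
    · rintro rfl
      rw [Pi.single_eq_same, Pi.single_eq_of_ne (Ne.symm hab)] at q1
      linarith
    · rintro rfl
      rw [Pi.single_eq_same, Pi.single_eq_of_ne hab] at q1
      linarith
  have ha : a = i ∨ a = j := by
    by_contra hcon
    push Not at hcon
    exact (e3 a hcon.1 hcon.2).1 rfl
  have hb : b = i ∨ b = j := by
    by_contra hcon
    push Not at hcon
    exact (e3 b hcon.1 hcon.2).2 rfl
  rcases ha with rfl | rfl <;> rcases hb with rfl | rfl
  · exact absurd rfl hab
  · left
    simp [Pi.single_eq_of_ne hij.symm, Pi.single_eq_of_ne hij] at e0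
    exact ⟨rfl, rfl, e0.symm⟩
  · right
    simp [Pi.single_eq_of_ne hij.symm, Pi.single_eq_of_ne hij] at e0
    exact ⟨rfl, rfl, e0.symm⟩
  · exact absurd rfl hab

/-! ### Maximal rook placements and the map `α` -/

/-- The set of squares with one rook at height `h i` in each column `i = 2, …, n`. -/
def colPlacement (n : ℕ) (h : ℕ → ℕ) : Finset (ℕ × ℕ) := (Icc 2 n).image fun i => (i, h i)

/-- The heights `h 2, …, h n` are those of a rook placement on `B_n`. -/
structure IsHeight (n : ℕ) (h : ℕ → ℕ) : Prop where
  pos : ∀ i ∈ Icc 2 n, 1 ≤ h i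
  le : ∀ i ∈ Icc 2 n, h i ≤ n + i - 1
  inj : ∀ i ∈ Icc 2 n, ∀ j ∈ Icc 2 n, h i = h j → i = j

theorem mem_colPlacement {n : ℕ} {h : ℕ → ℕ} {s : ℕ × ℕ} :
    s ∈ colPlacement n h ↔ s.1 ∈ Icc 2 n ∧ s.2 = h s.1 := by
  unfold colPlacement
  rw [mem_image]
  constructor
  · rintro ⟨i, hi, rfl⟩
    exact ⟨hi, rfl⟩
  · rintro ⟨h1, h2⟩
    exact ⟨s.1, h1, by rw [← h2]⟩

theorem colPlacement_inj {n : ℕ} {h h' : ℕ → ℕ} :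
    colPlacement n h = colPlacement n h' ↔ ∀ i ∈ Icc 2 n, h i = h' i := by
  constructor
  · intro he i hi
    have h1 : (i, h i) ∈ colPlacement n h := mem_colPlacement.2 ⟨hi, rfl⟩
    rw [he] at h1
    exact (mem_colPlacement.1 h1).2
  · intro he
    exact Finset.image_congr fun i hi => by simp only [he i hi]

theorem IsHeight.maximal {n : ℕ} {h : ℕ → ℕ} (hh : IsHeight n h) :
    Maximal (IsRookPlacement (board n)) (colPlacement n h) := by
  refine ⟨⟨?_, ?_⟩, ?_⟩
  · intro s hs
    obtain ⟨h1, h2⟩ := mem_colPlacement.1 hs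
    have h3 := hh.pos _ h1
    have h4 := hh.le _ h1
    rw [mem_Icc] at h1
    rw [mem_board]
    omega
  · intro s hs t ht hst
    obtain ⟨hs1, hs2⟩ := mem_colPlacement.1 hs
    obtain ⟨ht1, ht2⟩ := mem_colPlacement.1 ht
    have hne : s.1 ≠ t.1 := fun he => hst (Prod.ext he (by rw [hs2, ht2, he]))
    refine ⟨hne, fun he => hne (hh.inj _ hs1 _ ht1 (by rw [← hs2, ← ht2, he]))⟩
  · intro Q hQ hle s hs
    have hb := mem_board.1 (hQ.1 hs)
    have hmem : (s.1, h s.1) ∈ colPlacement n h :=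
      mem_colPlacement.2 ⟨mem_Icc.2 ⟨hb.1, hb.2.1⟩, rfl⟩
    by_contra hns
    exact (hQ.2 s hs _ (hle hmem) fun he => hns (he ▸ hmem)).1 rfl

/-- A maximal placement has a rook in every column: were a column empty, at most `n - 2` rooks would
be present, and one of the rows `1, …, n`, which meet every column, would be free for another rook.
-/
theorem exists_height {n : ℕ} {P : Finset (ℕ × ℕ)}
    (hP : Maximal (IsRookPlacement (board n)) P) :
    ∃ h, IsHeight n h ∧ P = colPlacement n h := by
  have hinj1 : Set.InjOn Prod.fst (P : Set (ℕ × ℕ)) := fun s hs t ht he => by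
    by_contra hne
    exact (hP.1.2 s hs t ht hne).1 he
  have hcol : ∀ i ∈ Icc 2 n, ∃ j, (i, j) ∈ P := by
    intro i hi
    by_contra! hno
    rw [mem_Icc] at hi
    have h1 : P.image Prod.fst ⊆ (Icc 2 n).erase i := by
      intro a ha
      obtain ⟨s, hs, rfl⟩ := mem_image.1 ha
      have hb := mem_board.1 (hP.1.1 hs)
      refine mem_erase.2 ⟨fun he => hno s.2 (he ▸ hs), mem_Icc.2 ⟨hb.1, hb.2.1⟩⟩
    have h2 := card_le_card h1
    rw [card_image_of_injOn hinj1, card_erase_of_mem (mem_Icc.2 hi), Nat.card_Icc] at h2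
    have h3 : #(P.image Prod.snd) < #(Icc 1 n) := by
      have := card_image_le (s := P) (f := Prod.snd)
      rw [Nat.card_Icc]
      omega
    obtain ⟨j, hj, hjP⟩ := exists_mem_notMem_of_card_lt_card h3
    rw [mem_Icc] at hj
    have hrow : ∀ s ∈ P, s.2 ≠ j := fun s hs he => hjP (mem_image.2 ⟨s, hs, he⟩)
    have hcol' : ∀ s ∈ P, s.1 ≠ i := fun s hs he => hno s.2 (he ▸ hs)
    have hins : IsRookPlacement (board n) (insert (i, j) P) := by
      refine ⟨insert_subset (mem_board.2 (by simp only; omega)) hP.1.1, ?_⟩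
      intro s hs t ht hst
      rcases mem_insert.1 hs with rfl | hs <;> rcases mem_insert.1 ht with rfl | ht
      · exact absurd rfl hst
      · exact ⟨(hcol' t ht).symm, (hrow t ht).symm⟩
      · exact ⟨hcol' s hs, hrow s hs⟩
      · exact hP.1.2 s hs t ht hst
    exact hno j (hP.2 hins (subset_insert _ _) (mem_insert_self _ _))
  choose! h hh using hcol
  have hb : ∀ i ∈ Icc 2 n, _ := fun i hi => mem_board.1 (hP.1.1 (hh i hi))
  refine ⟨h, ⟨fun i hi => (hb i hi).2.2.1, fun i hi => (hb i hi).2.2.2, ?_⟩, ?_⟩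
  · intro i hi j hj he
    by_contra hne
    exact (hP.1.2 _ (hh i hi) _ (hh j hj) fun h => hne (Prod.ext_iff.1 h).1).2 he
  · ext s
    rw [mem_colPlacement]
    constructor
    · intro hs
      have hb := mem_board.1 (hP.1.1 hs)
      have hi : s.1 ∈ Icc 2 n := mem_Icc.2 ⟨hb.1, hb.2.1⟩
      exact ⟨hi, (Prod.ext_iff.1 (hinj1 hs (hh _ hi) rfl)).2⟩
    · rintro ⟨h1, h2⟩
      have := hh _ h1
      rwa [← h2] at this

/-- The rows of column `c` of `B_n` without laser fire. -/
def freeRows (n : ℕ) (h : ℕ → ℕ) (c : ℕ) : Finset ℕ :=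
  Icc 1 (n + c - 1) \ (Icc 2 (c - 1)).image h

theorem mem_freeRows {n : ℕ} {h : ℕ → ℕ} {c r : ℕ} :
    r ∈ freeRows n h c ↔ (1 ≤ r ∧ r ≤ n + c - 1) ∧ ∀ j, 2 ≤ j → j < c → h j ≠ r := by
  simp only [freeRows, mem_sdiff, mem_Icc, mem_image, not_exists, not_and]
  refine and_congr_right fun _ => forall_congr' fun j => ?_
  constructor
  · exact fun hj h1 h2 => hj ⟨h1, by omega⟩
  · exact fun hj h1 => hj h1.1 (by omega)

/-- The column has `n + c - 1` squares. The `c - 2` earlier rooks lie in distinct rows, all low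
enough for their lasers to cross this column. -/
theorem card_freeRows {n c : ℕ} {h : ℕ → ℕ}
    (pos : ∀ j, 2 ≤ j → j < c → 1 ≤ h j) (le : ∀ j, 2 ≤ j → j < c → h j ≤ n + j - 1)
    (inj : ∀ i j, 2 ≤ i → i < j → j < c → h i ≠ h j) (hc : 2 ≤ c) :
    #(freeRows n h c) = n + 1 := by
  unfold freeRows
  rw [card_sdiff_of_subset, card_image_of_injOn, Nat.card_Icc, Nat.card_Icc]
  · omega
  · intro i hi j hj he
    rw [mem_coe, mem_Icc] at hi hj
    rcases lt_trichotomy i j with hlt | rfl | hlt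
    · exact absurd he (inj i j hi.1 hlt (by omega))
    · rfl
    · exact absurd he.symm (inj j i hj.1 hlt (by omega))
  · intro r hr
    obtain ⟨j, hj, rfl⟩ := mem_image.1 hr
    rw [mem_Icc] at hj ⊢
    have := pos j hj.1 (by omega)
    have := le j hj.1 (by omega)
    omega

theorem laserWord_colPlacement {n : ℕ} {h : ℕ → ℕ} (hh : IsHeight n h) (i : Fin n)
    (hi : (i : ℕ) ≠ 0) : laserWord (colPlacement n h) i =
      #{r ∈ freeRows n h (i + 1) | r ≤ h (i + 1)} := by
  have hic : (i : ℕ) + 1 ∈ Icc 2 n := mem_Icc.2 ⟨by omega, i.2⟩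
  have hle := hh.le _ hic
  classical
  rw [laserWord, if_neg hi]
  refine card_bij (fun s _ => s.2) ?_ ?_ ?_
  · intro s hs
    rw [mem_filter, mem_board] at hs
    obtain ⟨hb, hs1, ⟨r, hr, hr1, hr2⟩, hl⟩ := hs
    obtain ⟨-, hr3⟩ := mem_colPlacement.1 hr
    rw [hr3, hr1, hs1] at hr2
    refine mem_filter.2 ⟨mem_freeRows.2 ⟨⟨hb.2.2.1, by omega⟩, fun j hj2 hj he => hl ?_⟩, hr2⟩
    exact ⟨(j, h j), mem_colPlacement.2 ⟨mem_Icc.2 ⟨hj2, by omega⟩, rfl⟩, by simp only; omega, he⟩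
  · intro s hs t ht he
    rw [mem_filter] at hs ht
    exact Prod.ext (hs.2.1.trans ht.2.1.symm) he
  · intro r hr
    obtain ⟨hr1, hr2⟩ := mem_filter.1 hr
    rw [mem_freeRows] at hr1
    refine ⟨((i : ℕ) + 1, r), mem_filter.2 ⟨mem_board.2 ?_, rfl, ?_, ?_⟩, rfl⟩
    · simp only
      omega
    · exact ⟨(i + 1, h (i + 1)), mem_colPlacement.2 ⟨hic, rfl⟩, rfl, hr2⟩
    · rintro ⟨s, hs, hs1, hs2⟩
      obtain ⟨hs3, hs4⟩ := mem_colPlacement.1 hs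
      exact hr1.2 s.1 (mem_Icc.1 hs3).1 hs1 (hs4 ▸ hs2)

/-- The witness is the `v`-th smallest element of `S`, whose index is `v - 1` when counted from
zero. -/
theorem exists_card_filter_le {S : Finset ℕ} {v : ℕ} (hv : 1 ≤ v) (hvS : v ≤ #S) :
    ∃ a ∈ S, #{s ∈ S | s ≤ a} = v := by
  let k : Fin #S := ⟨v - 1, by omega⟩
  refine ⟨S.orderEmbOfFin rfl k, S.orderEmbOfFin_mem rfl k, ?_⟩
  have : ({s ∈ S | s ≤ S.orderEmbOfFin rfl k} : Finset ℕ) =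
      (Iic k).map (S.orderEmbOfFin rfl).toEmbedding := by
    ext s
    rw [mem_filter, mem_map]
    constructor
    · rintro ⟨hs, hle⟩
      rw [← Finset.mem_coe, ← S.range_orderEmbOfFin rfl] at hs
      obtain ⟨l, rfl⟩ := hs
      exact ⟨l, mem_Iic.2 ((S.orderEmbOfFin rfl).le_iff_le.1 hle), rfl⟩
    · rintro ⟨l, hl, rfl⟩
      exact ⟨S.orderEmbOfFin_mem rfl l, (S.orderEmbOfFin rfl).le_iff_le.2 (mem_Iic.1 hl)⟩
  rw [this, card_map, Fin.card_Iic]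
  simp only [k]
  omega

theorem card_filter_le_inj {S : Finset ℕ} {a b : ℕ} (ha : a ∈ S) (hb : b ∈ S)
    (h : #{s ∈ S | s ≤ a} = #{s ∈ S | s ≤ b}) : a = b := by
  wlog hab : a < b generalizing a b
  · rcases (not_lt.1 hab).eq_or_lt with h1 | h1
    · exact h1.symm
    · exact (this hb ha h.symm h1).symm
  · exfalso
    refine h.not_lt (card_lt_card ?_)
    rw [ssubset_iff_of_subset]
    · exact ⟨b, by simp [hb], by simp [hab]⟩
    · intro s hs
      rw [mem_filter] at hs ⊢
      exact ⟨hs.1, by omega⟩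

theorem IsHeight.mem_freeRows {n : ℕ} {h : ℕ → ℕ} (hh : IsHeight n h) {c : ℕ}
    (hc : c ∈ Icc 2 n) : h c ∈ freeRows n h c := by
  refine ShiIsh.mem_freeRows.2 ⟨⟨hh.pos c hc, hh.le c hc⟩, fun j hj hjc he => ?_⟩
  have := hh.inj j (mem_Icc.2 ⟨hj, by have := (mem_Icc.1 hc).2; omega⟩) c hc he
  omega

theorem laserWord_mem {n : ℕ} {h : ℕ → ℕ} (hh : IsHeight n h) (i : Fin n) :
    1 ≤ laserWord (colPlacement n h) i ∧ laserWord (colPlacement n h) i ≤ n + 1 := by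
  by_cases hi : (i : ℕ) = 0
  · simp [laserWord, hi]
  · have hic : (i : ℕ) + 1 ∈ Icc 2 n := mem_Icc.2 ⟨by omega, i.2⟩
    rw [laserWord_colPlacement hh i hi]
    constructor
    · exact card_pos.2 ⟨h (i + 1), mem_filter.2 ⟨hh.mem_freeRows hic, le_rfl⟩⟩
    · rw [← card_freeRows (n := n) (h := h) (c := i + 1)]
      · exact card_filter_le _ _
      · exact fun j h1 h2 => hh.pos j (mem_Icc.2 ⟨h1, by omega⟩)
      · exact fun j h1 h2 => hh.le j (mem_Icc.2 ⟨h1, by omega⟩)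
      · exact fun a b h1 h2 h3 he => h2.ne (hh.inj a (mem_Icc.2 ⟨h1, by omega⟩) b
          (mem_Icc.2 ⟨by omega, by omega⟩) he)
      · omega

theorem alpha_sameOrbit {n : ℕ} (P : MaxRook (board n)) :
    SameOrbit n (laserWord P.1) (alpha n P).1 :=
  (cycle_lemma (laserWord P.1)).choose_spec.1.2

theorem alpha_injective (n : ℕ) [NeZero n] : Function.Injective (alpha n) := by
  rintro ⟨P, hP⟩ ⟨P', hP'⟩ he
  obtain ⟨h, hh, rfl⟩ := exists_height hP
  obtain ⟨h', hh', rfl⟩ := exists_height hP'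
  obtain ⟨c, hc⟩ := alpha_sameOrbit ⟨_, hP⟩
  obtain ⟨c', hc'⟩ := alpha_sameOrbit ⟨_, hP'⟩
  rw [he] at hc
  simp only at hc hc'
  -- Both laser words begin with 1, so reaching the same parking function takes the same shift.
  have hcc : c ≡ c' [MOD n + 1] := by
    have := (hc 0).symm.trans (hc' 0)
    simp only [laserWord, Fin.val_zero, if_pos] at this
    exact Nat.ModEq.add_left_cancel' 1 this
  have hv : ∀ i : Fin n, laserWord (colPlacement n h) i = laserWord (colPlacement n h') i := by
    intro i
    have h1 : laserWord (colPlacement n h) i ≡ laserWord (colPlacement n h') i [MOD n + 1] :=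
      Nat.ModEq.add_right_cancel hcc ((hc i).symm.trans (hc' i))
    obtain ⟨h2, h3⟩ := laserWord_mem hh i
    obtain ⟨h4, h5⟩ := laserWord_mem hh' i
    obtain ⟨a, ha⟩ := Nat.exists_eq_add_of_le h2
    obtain ⟨b, hb⟩ := Nat.exists_eq_add_of_le h4
    rw [ha, hb] at h1 ⊢
    have h6 := Nat.ModEq.add_left_cancel' 1 h1
    rw [Nat.ModEq, Nat.mod_eq_of_lt (by omega), Nat.mod_eq_of_lt (by omega)] at h6
    rw [h6]
  -- If the earlier columns agree, so do the free squares, and the number of free squares weakly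
  -- below the rook fixes its height.
  have key : ∀ c, c ∈ Icc 2 n → h c = h' c := by
    intro c
    induction c using Nat.strong_induction_on with
    | _ c ih =>
      intro hc
      have hc2 := mem_Icc.1 hc
      have hfree : freeRows n h c = freeRows n h' c := by
        ext r
        simp only [mem_freeRows]
        refine and_congr_right fun _ => forall_congr' fun j => forall_congr' fun hj =>
          forall_congr' fun hjc => ?_
        rw [ih j hjc (mem_Icc.2 ⟨hj, by omega⟩)]
      have h1 := hv ⟨c - 1, by omega⟩
      have hc1 : c - 1 + 1 = c := by omega
      rw [laserWord_colPlacement hh _ (by simp only; omega),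
        laserWord_colPlacement hh' _ (by simp only; omega)] at h1
      simp only [hc1] at h1
      rw [← hfree] at h1
      exact card_filter_le_inj (hh.mem_freeRows hc) (hfree ▸ hh'.mem_freeRows hc) h1
  exact Subtype.ext (colPlacement_inj.2 key)

/-- The rooks are placed greedily from left to right: the free rows of a column depend only on
earlier columns, so later choices do not disturb them. -/
theorem exists_height_of_word (n : ℕ) (v : ℕ → ℕ) (hv : ∀ c, 1 ≤ v c ∧ v c ≤ n + 1) :
    ∃ h, IsHeight n h ∧ ∀ c ∈ Icc 2 n, #{r ∈ freeRows n h c | r ≤ h c} = v c := by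
  have key : ∀ m : ℕ, ∃ h : ℕ → ℕ, ∀ c, 2 ≤ c → c < m →
      h c ∈ freeRows n h c ∧ #{r ∈ freeRows n h c | r ≤ h c} = v c := by
    intro m
    induction m with
    | zero => exact ⟨id, by omega⟩
    | succ m ih =>
      obtain ⟨h, hh⟩ := ih
      by_cases hm : 2 ≤ m
      · have hcard : #(freeRows n h m) = n + 1 := by
          refine card_freeRows ?_ ?_ ?_ hm
          · exact fun j h1 h2 => (mem_freeRows.1 (hh j h1 h2).1).1.1
          · exact fun j h1 h2 => (mem_freeRows.1 (hh j h1 h2).1).1.2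
          · exact fun i j h1 h2 h3 => (mem_freeRows.1 (hh j (by omega) h3).1).2 i h1 h2
        obtain ⟨a, ha, hav⟩ := exists_card_filter_le (hv m).1 ((hv m).2.trans hcard.ge)
        have hfree : ∀ c ≤ m, freeRows n (Function.update h m a) c = freeRows n h c := by
          intro c hc
          ext r
          simp only [mem_freeRows]
          refine and_congr_right fun _ => forall_congr' fun j => forall_congr' fun hj =>
            forall_congr' fun hjc => ?_
          rw [Function.update_of_ne (by omega)]
        refine ⟨Function.update h m a, fun c hc2 hcm => ?_⟩
        rw [hfree c (by omega)]
        rcases (Nat.lt_succ_iff.1 hcm).eq_or_lt with rfl | hlt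
        · rw [Function.update_self]
          exact ⟨ha, hav⟩
        · rw [Function.update_of_ne hlt.ne]
          exact hh c hc2 hlt
      · exact ⟨h, by omega⟩
  obtain ⟨h, hh⟩ := key (n + 1)
  have hm : ∀ c ∈ Icc 2 n, h c ∈ freeRows n h c := fun c hc =>
    (hh c (mem_Icc.1 hc).1 (Nat.lt_succ_of_le (mem_Icc.1 hc).2)).1
  refine ⟨h, ⟨fun c hc => (mem_freeRows.1 (hm c hc)).1.1,
    fun c hc => (mem_freeRows.1 (hm c hc)).1.2, ?_⟩, fun c hc =>
    (hh c (mem_Icc.1 hc).1 (Nat.lt_succ_of_le (mem_Icc.1 hc).2)).2⟩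
  intro i hi j hj he
  rcases lt_trichotomy i j with hlt | rfl | hlt
  · exact absurd he ((mem_freeRows.1 (hm j hj)).2 i (mem_Icc.1 hi).1 hlt)
  · rfl
  · exact absurd he.symm ((mem_freeRows.1 (hm i hi)).2 j (mem_Icc.1 hj).1 hlt)

theorem alpha_surjective (n : ℕ) [NeZero n] : Function.Surjective (alpha n) := by
  rintro ⟨w, hw⟩
  -- The orbit is normalized to have first letter 1: `n * w 0` stands for `-w 0` modulo `n + 1`.
  let v : ℕ → ℕ := fun c =>
    (if hc : c - 1 < n then w ⟨c - 1, hc⟩ + n * w 0 else 0) % (n + 1) + 1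
  have hv : ∀ c, 1 ≤ v c ∧ v c ≤ n + 1 := fun c =>
    ⟨by simp [v], Nat.succ_le_of_lt (Nat.mod_lt _ n.succ_pos)⟩
  obtain ⟨h, hh, hhv⟩ := exists_height_of_word n v hv
  have hlw : ∀ i : Fin n, laserWord (colPlacement n h) i = (w i + n * w 0) % (n + 1) + 1 := by
    intro i
    by_cases hi : (i : ℕ) = 0
    · have hi0 : i = 0 := Fin.ext (by simpa using hi)
      subst hi0
      have : w 0 + n * w 0 = (n + 1) * w 0 := by ring
      rw [this, Nat.mul_mod_right]
      simp [laserWord]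
    · rw [laserWord_colPlacement hh i hi, hhv _ (mem_Icc.2 ⟨by omega, i.2⟩)]
      simp [v]
  refine ⟨⟨_, hh.maximal⟩, Subtype.ext ?_⟩
  have horb : SameOrbit n (laserWord (colPlacement n h)) w := by
    -- The shift back is `w 0 - 1`, written without subtraction modulo `n + 1`.
    refine ⟨w 0 + n, fun i => ?_⟩
    rw [hlw]
    have h1 : (w i + n * w 0) % (n + 1) + (1 + (w 0 + n)) ≡ w i + n * w 0 + (1 + (w 0 + n))
      [MOD n + 1] := (Nat.mod_modEq _ _).add_right _
    have h2 : w i + n * w 0 + (1 + (w 0 + n)) = w i + (n + 1) * (w 0 + 1) := by ring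
    rw [h2] at h1
    have h3 : w i + (n + 1) * (w 0 + 1) ≡ w i [MOD n + 1] := by simp [Nat.ModEq]
    rw [add_assoc]
    exact (h1.trans h3).symm
  exact parking_unique (alpha n _).2 hw (alpha_sameOrbit _) horb

theorem alpha_bijective (n : ℕ) [NeZero n] : Function.Bijective (alpha n) :=
  ⟨alpha_injective n, alpha_surjective n⟩

/-! ### Ish regions and the map `ρ` -/

/-- Permutations are read here as maps from letters to positions. Strong induction on the position
compares the letters at the first place where the two could differ. -/
theorem eq_of_first_difference {n : ℕ} {p p' : Equiv.Perm (Fin n)}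
    (h : ∀ i i', p i = p' i' → (∀ j, p j < p i ∨ p' j < p i → p j = p' j) → i = i') : p = p' := by
  have key : ∀ k : ℕ, ∀ i, (p i : ℕ) = k ∨ (p' i : ℕ) = k → p i = p' i := by
    intro k
    induction k using Nat.strong_induction_on with
    | _ k ih =>
      have hagree : ∀ (i : Fin n), (p i : ℕ) = k → ∀ j, p j < p i ∨ p' j < p i → p j = p' j := by
        intro i hi j hj
        rcases hj with hj | hj
        · exact ih _ (by rw [← hi]; exact hj) j (Or.inl rfl)
        · exact ih _ (by rw [← hi]; exact hj) j (Or.inr rfl)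
      rintro i (hi | hi)
      · have := h i (p'.symm (p i)) (by simp) (hagree i hi)
        nth_rewrite 2 [this]
        simp
      · have hpi : p (p.symm (p' i)) = p' i := by simp
        have := h (p.symm (p' i)) i hpi (hagree _ (by rw [hpi, hi]))
        nth_rewrite 1 [← this]
        simp
  exact Equiv.ext fun i => key _ i (Or.inl rfl)

theorem ish_finite (n : ℕ) [NeZero n] : (ish n).Finite := by
  refine ((Set.finite_range fun q : Fin n × Fin n => diffHyperplane q.1 q.2 0).union
    (Set.finite_range fun q : Fin n × Fin n => diffHyperplane 0 q.2 ((q.1 : ℝ) + 1))).subset ?_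
  rintro H (⟨i, j, -, rfl⟩ | ⟨i, j, -, rfl⟩)
  · exact Or.inl ⟨(i, j), rfl⟩
  · exact Or.inr ⟨(i, j), rfl⟩

theorem sameSide_zero_of_lt_iff {n : ℕ} {x y : Fin n → ℝ} (hx : Function.Injective x)
    (h : ∀ i j, x j < x i ↔ y j < y i) {i j : Fin n} (hij : i ≠ j) : SameSide x y i j 0 := by
  rcases lt_or_gt_of_ne (hx.ne hij) with h1 | h1
  · have := (h j i).1 h1
    exact Or.inl ⟨by linarith, by linarith⟩
  · have := (h i j).1 h1
    exact Or.inr ⟨by linarith, by linarith⟩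

theorem injective_of_mem_complement {n : ℕ} {A : Arrangement n} (hA : cox n ⊆ A)
    {x : Fin n → ℝ} (hx : x ∈ complement A) : Function.Injective x := by
  intro i j he
  by_contra hne
  rcases lt_or_gt_of_ne hne with h | h
  · exact hx _ (hA ⟨i, j, h, rfl⟩) (by rw [mem_diffHyperplane, he, sub_self])
  · exact hx _ (hA ⟨j, i, h, rfl⟩) (by rw [mem_diffHyperplane, he, sub_self])

theorem mem_ish {n : ℕ} [NeZero n] {i j : Fin n} (h : i < j) :
    diffHyperplane 0 j ((i : ℝ) + 1) ∈ ish n := Or.inr ⟨i, j, h, rfl⟩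

theorem ish_sub_ne {n : ℕ} [NeZero n] {x : Fin n → ℝ} (hx : x ∈ complement (ish n)) {i j : Fin n}
    (h : i < j) : x 0 - x j ≠ (i : ℝ) + 1 := fun he => hx _ (mem_ish h) he

theorem IsCeiling.not_sub_lt {n : ℕ} {A : Arrangement n} {R : Region A} {i j : Fin n} {c d : ℝ}
    (hij : i ≠ j) (h : IsCeiling A R.1 (diffHyperplane i j c)) (hd : d < c) :
    ¬ ∀ x ∈ R.1, x i - x j ≤ d := by
  intro hle
  have h1 : diffHyperplane i j c ≤ diffHyperplane i j d := by
    refine h.eq_of_facet fun x hx hxH => ?_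
    have := closure_sub_le hle hx
    rw [mem_diffHyperplane] at hxH
    linarith
  rcases diffHyperplane_le hij h1 with h2 | h2 | h2
  · exact hij h2.1
  · exact hd.ne h2.2.2
  · exact hij h2.1

/-- In terms of `v_j = x 0 - x j`, all values in `[v_l, i + 1]` are pushed, in the same order, just
beyond `i + 1`. Apart from `l`, the letters moved have index at most `i`, so all their Ish walls lie
at height at most `i`, already below them; only the wall of `l` is crossed. -/
theorem ish_isCeiling_of {n : ℕ} [NeZero n] (R : Region (ish n)) {x : Fin n → ℝ} (hx : x ∈ R.1)
    {i l : Fin n} (hil : i < l) (hlt : x 0 - x l < (i : ℝ) + 1) (hgt : (i : ℝ) < x 0 - x l)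
    (hfar : ∀ j, i < j → x j < x l → (i : ℝ) + 1 < x 0 - x j) :
    IsCeiling (ish n) R.1 (diffHyperplane 0 l ((i : ℝ) + 1)) := by
  have hxc := R.subset hx
  have hinj := injective_of_mem_complement (cox_subset_ish n) hxc
  have hi0 : (0 : ℝ) ≤ i := by positivity
  -- `m` is a ceiling for the pushed values: it lies below every value already beyond `i + 1`, which
  -- preserves the order, and below `i + 2`, so that `l` crosses no second wall.
  obtain ⟨m, hm1, hm2⟩ := Order.exists_between_finsets ({(i : ℝ) + 1} : Finset ℝ)
    (insert ((i : ℝ) + 2) ((univ.image fun j => x 0 - x j).filter fun v => (i : ℝ) + 1 < v)) (by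
      intro a ha b hb
      rw [mem_singleton] at ha
      subst ha
      rcases mem_insert.1 hb with rfl | hb
      · linarith
      · exact (mem_filter.1 hb).2)
  replace hm1 : (i : ℝ) + 1 < m := hm1 _ (mem_singleton_self _)
  have hm3 : m < i + 2 := hm2 _ (mem_insert_self _ _)
  have hm4 : ∀ j, (i : ℝ) + 1 < x 0 - x j → m < x 0 - x j := fun j hj =>
    hm2 _ (mem_insert_of_mem (mem_filter.2 ⟨mem_image_of_mem _ (mem_univ j), hj⟩))
  let η : ℝ := (m - (i + 1)) / 2
  have hη : 0 < η := by simp only [η]; linarith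
  have hη2 : (i : ℝ) + 1 + η * 2 = m := by simp only [η]; ring
  let φ : ℝ → ℝ := fun v => if v < x 0 - x l ∨ (i : ℝ) + 1 < v then v
    else i + 1 + η * (1 + (v - (x 0 - x l)))
  have hφid : ∀ v, (v < x 0 - x l ∨ (i : ℝ) + 1 < v) → φ v = v := fun v hv => if_pos hv
  have hφmid : ∀ v, x 0 - x l ≤ v → v ≤ (i : ℝ) + 1 →
      φ v = i + 1 + η * (1 + (v - (x 0 - x l))) := fun v h1 h2 =>
    if_neg (by push Not; exact ⟨h1, h2⟩)
  have hφmid' : ∀ v, x 0 - x l ≤ v → v ≤ (i : ℝ) + 1 → (i : ℝ) + 1 < φ v ∧ φ v < m := by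
    intro v h1 h2
    rw [hφmid v h1 h2]
    constructor
    · have : 0 < η * (1 + (v - (x 0 - x l))) := mul_pos hη (by linarith)
      linarith
    · have : η * (1 + (v - (x 0 - x l))) < η * 2 := mul_lt_mul_of_pos_left (by linarith) hη
      linarith
  have hcases : ∀ v, (v < x 0 - x l ∨ (i : ℝ) + 1 < v) ∨ (x 0 - x l ≤ v ∧ v ≤ (i : ℝ) + 1) := by
    intro v
    by_cases h : v < x 0 - x l ∨ (i : ℝ) + 1 < v
    · exact Or.inl h
    · push Not at h
      exact Or.inr h
  have hφge : ∀ v, v ≤ φ v := by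
    intro v
    rcases hcases v with h | h
    · rw [hφid v h]
    · exact h.2.trans (hφmid' v h.1 h.2).1.le
  have hφmono : ∀ a b, x b < x a → φ (x 0 - x a) < φ (x 0 - x b) := by
    intro a b hab
    have hab' : x 0 - x a < x 0 - x b := by linarith
    rcases hcases (x 0 - x a) with (h | h) | h
    · rw [hφid _ (Or.inl h)]
      exact hab'.trans_le (hφge _)
    · rw [hφid _ (Or.inr h), hφid _ (Or.inr (h.trans hab'))]
      exact hab'
    · rcases le_or_gt (x 0 - x b) ((i : ℝ) + 1) with h2 | h2
      · rw [hφmid _ h.1 h.2, hφmid _ (h.1.trans hab'.le) h2]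
        have := mul_lt_mul_of_pos_left hab' hη
        linarith
      · rw [hφid _ (Or.inr h2)]
        exact (hφmid' _ h.1 h.2).2.trans (hm4 b h2)
  let x' : Fin n → ℝ := fun j => x 0 - φ (x 0 - x j)
  have hφ0 : φ (x 0 - x 0) = 0 := by
    rw [sub_self]
    exact hφid 0 (Or.inl (by linarith))
  have hx'v : ∀ j, x' 0 - x' j = φ (x 0 - x j) := by
    intro j
    simp only [x', hφ0]
    ring
  have hlow : ∀ a b, x b < x a → x' b < x' a := fun a b hab => by
    have := hφmono a b hab
    simp only [x']
    linarith
  have hord : ∀ a b, x b < x a ↔ x' b < x' a := by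
    intro a b
    refine ⟨hlow a b, fun h => ?_⟩
    by_contra hne
    rcases (not_lt.1 hne).eq_or_lt with he | hlt
    · simp only [x', he, lt_irrefl] at h
    · exact lt_asymm h (hlow _ _ hlt)
  refine isCeiling_of_adjacent (ish_finite n) R (by positivity) (mem_ish hil) (x' := x') hx hlt ?_ ?_
  · rw [hx'v]
    exact (hφmid' _ le_rfl hlt.le).1
  · rintro K (⟨a, b, hab, rfl⟩ | ⟨t, j, htj, rfl⟩) hne
    · exact ⟨a, b, 0, rfl, sameSide_zero_of_lt_iff hinj hord hab.ne⟩
    · refine ⟨0, j, _, rfl, ?_⟩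
      rcases hcases (x 0 - x j) with h | ⟨h1, h2⟩
      · refine SameSide.of_lt_iff (ish_sub_ne hxc htj) ?_ ?_
        · rw [hx'v, hφid _ h]
          exact ish_sub_ne hxc htj
        · rw [hx'v, hφid _ h]
      · have hbelow : t < i → SameSide x x' 0 j ((t : ℝ) + 1) := by
          intro hti
          have : (t : ℝ) + 1 ≤ i := by exact_mod_cast hti
          have := hφge (x 0 - x j)
          exact Or.inr ⟨by linarith, by rw [hx'v]; linarith⟩
        rcases lt_trichotomy t i with hti | rfl | hti
        · exact hbelow hti
        · exfalso
          have hjl : j ≠ l := fun h => hne (by rw [h])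
          have hxjl : x j < x l := lt_of_le_of_ne (by linarith) (hinj.ne hjl)
          linarith [hfar j htj hxjl]
        · by_cases hjl : j = l
          · have : (i : ℝ) + 1 ≤ t := by exact_mod_cast hti
            exact Or.inl ⟨by linarith, by rw [hx'v]; linarith [(hφmid' _ h1 h2).2]⟩
          · exfalso
            have hxjl : x j < x l := lt_of_le_of_ne (by linarith) (hinj.ne hjl)
            linarith [hfar j (hti.trans htj) hxjl]

theorem Region.sub_le_of_le {n : ℕ} {A : Arrangement n} (R : Region A) {i j : Fin n} {c : ℝ}
    (hA : diffHyperplane i j c ∈ A) {x : Fin n → ℝ} (hx : x ∈ R.1)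
    (h : x i - x j ≤ c) : ∀ y ∈ R.1, y i - y j ≤ c := fun _ hy =>
  (R.lt_of_lt hA hx hy (lt_of_le_of_ne h fun he => R.subset hx _ hA he)).le

theorem Region.le_of_le {n : ℕ} {A : Arrangement n} (hA : cox n ⊆ A) (R : Region A)
    {x : Fin n → ℝ} (hx : x ∈ R.1) {i j : Fin n} (h : x i ≤ x j) : ∀ y ∈ R.1, y i ≤ y j := by
  obtain ⟨π, hπ, -⟩ := exists_isOrder hA R
  intro y hy
  by_contra hlt
  exact h.not_gt ((hπ.sub_pos_iff hx _ _).2 ((hπ.sub_pos_iff hy _ _).1 (not_le.1 hlt)))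

/-- The ceilings of an Ish region, read off from any of its points. -/
theorem ish_isCeiling_iff {n : ℕ} [NeZero n] (R : Region (ish n)) {x : Fin n → ℝ} (hx : x ∈ R.1)
    {i l : Fin n} (hil : i < l) : IsCeiling (ish n) R.1 (diffHyperplane 0 l ((i : ℝ) + 1)) ↔
      x 0 - x l < (i : ℝ) + 1 ∧ (i : ℝ) < x 0 - x l ∧
        ∀ j, i < j → x j < x l → (i : ℝ) + 1 < x 0 - x j := by
  refine ⟨fun h => ?_, fun h => ish_isCeiling_of R hx hil h.1 h.2.1 h.2.2⟩
  have hl0 : (0 : Fin n) ≠ l := fun h0 => by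
    subst h0
    exact absurd hil (Fin.not_lt_zero i)
  have hi0 : (0 : ℝ) ≤ i := by positivity
  refine ⟨h.sub_lt (by positivity) hx, ?_, ?_⟩
  · by_contra hle
    rw [not_lt] at hle
    refine h.not_sub_lt hl0 (d := i) (by linarith) ?_
    -- The next lower wall `x 0 - x l = i` would keep the whole region away from the facet. It is a
    -- Coxeter hyperplane for `i = 0` and an Ish hyperplane otherwise.
    by_cases hi : (i : ℕ) = 0
    · intro y hy
      rw [hi, Nat.cast_zero] at hle ⊢
      linarith [R.le_of_le (cox_subset_ish n) hx (i := 0) (j := l) (by linarith) y hy]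
    · let i' : Fin n := ⟨i - 1, by omega⟩
      have hi' : ((i' : ℕ) : ℝ) + 1 = i := by
        have : (i' : ℕ) + 1 = i := by simp only [i']; omega
        exact_mod_cast this
      rw [← hi'] at hle ⊢
      refine R.sub_le_of_le (mem_ish (lt_trans ?_ hil)) hx hle
      simp only [i', Fin.lt_def]
      omega
  · intro j hij hjl
    by_contra hle
    have h1 := R.sub_le_of_le (mem_ish hij) hx (not_lt.1 hle)
    have h2 := R.le_of_le (cox_subset_ish n) hx hjl.le
    -- On the facet, `x 0 - x l = i + 1 ≥ x 0 - x j ≥ x 0 - x l` would force `x l = x j` throughout.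
    have h3 : diffHyperplane 0 l ((i : ℝ) + 1) ≤ diffHyperplane l j 0 := by
      refine h.eq_of_facet fun z hz hzH => ?_
      have q1 := closure_sub_le h1 hz
      have q2 := closure_sub_le (i := j) (j := l) (c := 0)
        (fun y hy => by linarith [h2 y hy]) hz
      rw [mem_diffHyperplane] at hzH ⊢
      linarith
    rcases diffHyperplane_le hl0 h3 with h4 | h4 | h4
    · rw [h4.1] at hjl
      exact lt_irrefl _ hjl
    · exact hl0 h4.1.symm
    · linarith [h4.2.2]

/-! ### Ish regions determined by their order and dots -/

/-- The number of dots over the letter `j`. -/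
def letterDots {n : ℕ} [NeZero n] (R : Region (ish n)) (j : Fin n) : ℕ :=
  ishDots R ((ishPerm R).symm j)

theorem ishPerm_lt_iff {n : ℕ} [NeZero n] (R : Region (ish n)) {x : Fin n → ℝ} (hx : x ∈ R.1)
    (i j : Fin n) : x j < x i ↔ (ishPerm R).symm i < (ishPerm R).symm j :=
  (isIshDiagram R).order.sub_pos_iff hx i j

theorem letterDots_eq {n : ℕ} [NeZero n] (R : Region (ish n)) {i l : Fin n} (hil : i < l)
    (h : IsCeiling (ish n) R.1 (diffHyperplane 0 l ((i : ℝ) + 1))) :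
    letterDots R l = (i : ℕ) + 1 := by
  have e : ishPerm R ((ishPerm R).symm l) = l := by simp
  exact (isIshDiagram R).dots ((ishPerm R).symm l) i (by rwa [e]) (by rwa [e])

theorem letterDots_spec {n : ℕ} [NeZero n] (R : Region (ish n)) {l : Fin n}
    (h : letterDots R l ≠ 0) : ∃ i : Fin n, i < l ∧ letterDots R l = (i : ℕ) + 1 ∧
      IsCeiling (ish n) R.1 (diffHyperplane 0 l ((i : ℝ) + 1)) := by
  have := ishDots_spec R _ h
  rwa [Equiv.apply_symm_apply] at this

theorem letterDots_zero {n : ℕ} [NeZero n] (R : Region (ish n)) : letterDots R 0 = 0 := by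
  by_contra h
  obtain ⟨i, hi, -⟩ := letterDots_spec R h
  exact absurd hi (Fin.not_lt_zero i)

/-- A ceiling with `m` dots confines `x 0 - x b` to the interval `(m - 1, m)`, so more dots means
further right; the letter 1 counts as having no dots. -/
theorem position_lt_of_letterDots_lt {n : ℕ} [NeZero n] (R : Region (ish n)) {a b : Fin n}
    (ha : a = 0 ∨ letterDots R a ≠ 0) (h : letterDots R a < letterDots R b) :
    (ishPerm R).symm a < (ishPerm R).symm b := by
  obtain ⟨x, hx⟩ := R.nonempty
  obtain ⟨i, hi, hib, hci⟩ := letterDots_spec R (l := b) (by omega)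
  have h1 := ((ish_isCeiling_iff R hx hi).1 hci).2.1
  have hi0 : (0 : ℝ) ≤ i := by positivity
  rw [← ishPerm_lt_iff R hx]
  rcases ha with rfl | ha
  · linarith
  · obtain ⟨k, hk, hka, hck⟩ := letterDots_spec R ha
    have h2 := ((ish_isCeiling_iff R hx hk).1 hck).1
    have h3 : (k : ℝ) + 1 ≤ i := by
      have : (k : ℕ) + 1 ≤ i := by omega
      exact_mod_cast this
    linarith

/-- Every Ish inequality is implied by the order together with a ceiling, so the diagram determines
the region. -/
theorem ish_sub_lt_iff {n : ℕ} [NeZero n] (R : Region (ish n)) {x : Fin n → ℝ} (hx : x ∈ R.1)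
    {i j : Fin n} (hij : i < j) : x 0 - x j < (i : ℝ) + 1 ↔
      (ishPerm R).symm j < (ishPerm R).symm 0 ∨ ∃ l, letterDots R l ≠ 0 ∧
        (ishPerm R).symm j ≤ (ishPerm R).symm l ∧ letterDots R l ≤ (i : ℕ) + 1 := by
  have hxc := R.subset hx
  have hi0 : (0 : ℝ) ≤ i := by positivity
  constructor
  · intro h
    by_cases hj0 : (ishPerm R).symm j < (ishPerm R).symm 0
    · exact Or.inl hj0
    right
    rw [← ishPerm_lt_iff R hx, not_lt] at hj0
    have hj0' : x j < x 0 := lt_of_le_of_ne hj0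
      ((injective_of_mem_complement (cox_subset_ish n) hxc).ne fun h0 => by
        rw [h0] at hij; exact absurd hij (Fin.not_lt_zero i))
    classical
    let S : Finset (Fin n × Fin n) := {s | s.1 < s.2 ∧ x 0 - x s.2 < (s.1 : ℝ) + 1 ∧
      (ishPerm R).symm j ≤ (ishPerm R).symm s.2 ∧ s.1 ≤ i}
    -- Among the valid inequalities implying the given one, take the smallest constant and then the
    -- rightmost letter. This extremal choice meets both conditions for a ceiling.
    obtain ⟨⟨k, l⟩, hs, hmin⟩ := S.exists_min_image
      (fun s => toLex (s.1, OrderDual.toDual ((ishPerm R).symm s.2)))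
      ⟨(i, j), by simp [S, hij, h]⟩
    simp only [S, mem_filter, mem_univ, true_and] at hs hmin
    obtain ⟨hkl, hlt, hpos, hki⟩ := hs
    have hlj : x l ≤ x j := by
      by_contra hcon
      exact hpos.not_gt ((ishPerm_lt_iff R hx _ _).1 (not_le.1 hcon))
    have hceil : IsCeiling (ish n) R.1 (diffHyperplane 0 l ((k : ℝ) + 1)) := by
      refine ish_isCeiling_of R hx hkl hlt ?_ ?_
      · by_contra hle
        rw [not_lt] at hle
        by_cases hk : (k : ℕ) = 0
        · rw [hk, Nat.cast_zero] at hle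
          linarith
        · let k' : Fin n := ⟨k - 1, by omega⟩
          have hk' : ((k' : ℕ) : ℝ) + 1 = k := by
            have : (k' : ℕ) + 1 = k := by simp only [k']; omega
            exact_mod_cast this
          have hkk : k' < k := by
            simp only [k', Fin.lt_def]
            omega
          have hlt' : x 0 - x l < (k' : ℝ) + 1 :=
            lt_of_le_of_ne (by rw [hk']; exact hle) (ish_sub_ne hxc (hkk.trans hkl))
          have := hmin (k', l) ⟨hkk.trans hkl, hlt', hpos, hkk.le.trans hki⟩
          rw [Prod.Lex.toLex_le_toLex] at this
          rcases this with h1 | h1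
          · exact lt_asymm h1 hkk
          · exact hkk.ne h1.1.symm
      · intro l' hkl' hll'
        by_contra hle
        have hlt' : x 0 - x l' < (k : ℝ) + 1 :=
          lt_of_le_of_ne (not_lt.1 hle) (ish_sub_ne hxc hkl')
        have hp := (ishPerm_lt_iff R hx _ _).1 hll'
        have := hmin (k, l') ⟨hkl', hlt', hpos.trans hp.le, hki⟩
        rw [Prod.Lex.toLex_le_toLex] at this
        rcases this with h1 | h1
        · exact lt_irrefl _ h1
        · exact (OrderDual.toDual_le_toDual.1 h1.2).not_gt hp
    have he := letterDots_eq R hkl hceil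
    refine ⟨l, by omega, hpos, ?_⟩
    rw [he]
    have : (k : ℕ) ≤ i := hki
    omega
  · rintro (h | ⟨l, hl, hjl, hli⟩)
    · rw [← ishPerm_lt_iff R hx] at h
      linarith
    · obtain ⟨k, hk, hkl, hck⟩ := letterDots_spec R hl
      have h1 := ((ish_isCeiling_iff R hx hk).1 hck).1
      have h2 : x l ≤ x j := by
        by_contra hcon
        exact hjl.not_gt ((ishPerm_lt_iff R hx _ _).1 (not_le.1 hcon))
      have h3 : (k : ℝ) ≤ i := by
        have : (k : ℕ) ≤ i := by omega
        exact_mod_cast this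
      linarith

theorem ishRegion_eq {n : ℕ} [NeZero n] {R R' : Region (ish n)} (hp : ishPerm R = ishPerm R')
    (hd : letterDots R = letterDots R') : R = R' := by
  obtain ⟨x, hx⟩ := R.nonempty
  obtain ⟨y, hy⟩ := R'.nonempty
  refine Region.eq_of_mem (R.mem_of_sameSide hx ?_) hy
  rintro K (⟨a, b, hab, rfl⟩ | ⟨i, j, hij, rfl⟩)
  · refine ⟨a, b, 0, rfl, sameSide_zero_of_lt_iff
      (injective_of_mem_complement (cox_subset_ish n) (R.subset hx)) (fun i j => ?_) hab.ne⟩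
    rw [ishPerm_lt_iff R hx, ishPerm_lt_iff R' hy, hp]
  · refine ⟨0, j, _, rfl, SameSide.of_lt_iff (ish_sub_ne (R.subset hx) hij)
      (ish_sub_ne (R'.subset hy) hij) ?_⟩
    rw [ish_sub_lt_iff R hx hij, ish_sub_lt_iff R' hy hij, hp, hd]

theorem rookHeight_eq {n : ℕ} [NeZero n] (R : Region (ish n)) (i : Fin n) : rookHeight R i =
    if letterDots R i = 0 then ((ishPerm R).symm i : ℕ) + 1 else n + letterDots R i := rfl

/-- Intersecting with the board discards just the rook of column 1. -/
theorem rho_val {n : ℕ} [NeZero n] (R : Region (ish n)) {h : ℕ → ℕ}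
    (hh : ∀ i : Fin n, i ≠ 0 → rookHeight R i = h (i + 1)) :
    (rho n R).1 = colPlacement n h := by
  ext s
  change s ∈ rhoHat R ∩ board n ↔ _
  rw [mem_inter, mem_colPlacement]
  constructor
  · rintro ⟨hs, hb⟩
    obtain ⟨i, -, rfl⟩ := mem_image.1 hs
    have hb' := mem_board.1 hb
    simp only at hb'
    refine ⟨mem_Icc.2 ⟨hb'.1, hb'.2.1⟩, hh i fun h0 => ?_⟩
    rw [h0, Fin.val_zero] at hb'
    omega
  · rintro ⟨h1, h2⟩
    rw [mem_Icc] at h1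
    let i : Fin n := ⟨s.1 - 1, by omega⟩
    have hi : (i : ℕ) + 1 = s.1 := by simp only [i]; omega
    have hi0 : i ≠ 0 := fun h0 => by rw [h0, Fin.val_zero] at hi; omega
    have hs : s = ((i : ℕ) + 1, rookHeight R i) := by
      refine Prod.ext hi.symm ?_
      rw [h2, hh i hi0, hi]
    rw [hs]
    exact ⟨mem_image.2 ⟨i, mem_univ _, rfl⟩, mem_board_rook R i (by omega)⟩

theorem rho_injective (n : ℕ) [NeZero n] : Function.Injective (rho n) := by
  intro R R' he
  have hval : ∀ R : Region (ish n), (rho n R).1 = colPlacement n fun c =>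
      if hc : c - 1 < n then rookHeight R ⟨c - 1, hc⟩ else 0 := fun R =>
    rho_val R fun i _ => by simp
  have hheight : ∀ i : Fin n, i ≠ 0 → rookHeight R i = rookHeight R' i := by
    have h1 : (rho n R).1 = (rho n R').1 := by rw [he]
    rw [hval, hval, colPlacement_inj] at h1
    intro i hi
    have hi0 : (i : ℕ) ≠ 0 := fun h0 => hi (Fin.ext (by simpa using h0))
    simpa using h1 (i + 1) (mem_Icc.2 ⟨by omega, i.2⟩)
  have hd : letterDots R = letterDots R' := by
    funext i
    by_cases hi : i = 0
    · rw [hi, letterDots_zero, letterDots_zero]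
    · have := hheight i hi
      rw [rookHeight_eq, rookHeight_eq] at this
      -- Heights up to `n` encode positions and larger ones encode dots, so the two cases cannot be
      -- confused.
      split_ifs at this <;> omega
  refine ishRegion_eq ?_ hd
  have hp : ∀ i, i ≠ 0 → letterDots R i = 0 → (ishPerm R).symm i = (ishPerm R').symm i := by
    intro i hi h0
    have := hheight i hi
    rw [rookHeight_eq, rookHeight_eq, ← hd, if_pos h0, if_pos h0] at this
    exact Fin.ext (by omega)
  have hinj : ∀ a b, (a = 0 ∨ letterDots R a ≠ 0) → (b = 0 ∨ letterDots R b ≠ 0) →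
      letterDots R a = letterDots R b → a = b := by
    intro a b ha hb hab
    by_cases h0 : letterDots R a = 0
    · rw [ha.resolve_right (not_not.2 h0), hb.resolve_right (not_not.2 (hab ▸ h0))]
    · exact (ishPerm R).symm.injective (ishDots_inj R h0 hab)
  have hsymm : (ishPerm R).symm = (ishPerm R').symm := by
    refine eq_of_first_difference fun i i' hii hag => ?_
    by_cases hi : i = 0 ∨ letterDots R i ≠ 0
    · by_cases hi' : i' = 0 ∨ letterDots R i' ≠ 0
      -- At the first disagreement, the letter with fewer dots must already have appeared in the
      -- other permutation, at an earlier position where both agree.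
      · rcases lt_trichotomy (letterDots R i) (letterDots R i') with hlt | heq | hlt
        · have h1 := position_lt_of_letterDots_lt R' (hd ▸ hi) (hd ▸ hlt)
          rw [← hii] at h1
          have h2 := hag i (Or.inr h1)
          rw [← h2] at h1
          exact absurd h1 (lt_irrefl _)
        · exact hinj _ _ hi hi' heq
        · have h1 := position_lt_of_letterDots_lt R hi' hlt
          have h2 := hag i' (Or.inl h1)
          rw [h2, ← hii] at h1
          exact absurd h1 (lt_irrefl _)
      · push Not at hi'
        have := hp i' hi'.1 hi'.2
        rw [← this] at hii
        exact (ishPerm R).symm.injective hii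
    · push Not at hi
      have := hp i hi.1 hi.2
      rw [this] at hii
      exact (ishPerm R').symm.injective hii
  exact Equiv.symm_bijective.injective hsymm

/-! ### Realization of Ish diagrams -/

/-- The positions not taken by `q` are as many as the elements of `D`; they are matched in
increasing order with the values of `d`. -/
theorem exists_perm_extending {n : ℕ} (D : Finset (Fin n)) (d : Fin n → ℕ)
    (hd : Set.InjOn d D) (q : Fin n → Fin n) (hq : Set.InjOn q (↑(univ \ D) : Set (Fin n))) :
    ∃ p : Equiv.Perm (Fin n), (∀ i ∉ D, p i = q i) ∧
      ∀ a ∈ D, ∀ b ∈ D, d a < d b → p a < p b := by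
  classical
  let F : Finset (Fin n) := univ \ (univ \ D).image q
  let K : Finset ℕ := D.image d
  have hF : #F = #D := by
    simp only [F]
    rw [card_univ_sdiff, card_image_of_injOn hq, card_univ_sdiff]
    have := card_le_univ D
    omega
  have hK : #K = #D := card_image_of_injOn hd
  let g : ∀ a ∈ D, Fin n := fun a ha =>
    F.orderEmbOfFin hF ((K.orderIsoOfFin hK).symm ⟨d a, mem_image_of_mem d ha⟩)
  have hgF : ∀ a ha, g a ha ∈ F := fun a ha => F.orderEmbOfFin_mem hF _
  have hg : ∀ a ha b hb, d a < d b → g a ha < g b hb := by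
    intro a ha b hb hab
    simp only [g]
    rw [OrderEmbedding.lt_iff_lt, OrderIso.lt_iff_lt]
    exact hab
  let p : Fin n → Fin n := fun a => if ha : a ∈ D then g a ha else q a
  have hpD : ∀ a (ha : a ∈ D), p a = g a ha := fun a ha => dif_pos ha
  have hpq : ∀ a, a ∉ D → p a = q a := fun a ha => dif_neg ha
  have hne : ∀ a ∈ D, ∀ b ∉ D, p a ≠ p b := by
    intro a ha b hb he
    rw [hpD a ha, hpq b hb] at he
    have h1 := hgF a ha
    rw [he] at h1
    exact (mem_sdiff.1 h1).2 (mem_image_of_mem q (mem_sdiff.2 ⟨mem_univ _, hb⟩))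
  have hinj : Function.Injective p := by
    intro a b he
    by_cases ha : a ∈ D <;> by_cases hb : b ∈ D
    · rcases lt_trichotomy (d a) (d b) with h | h | h
      · have := hg a ha b hb h
        rw [← hpD a ha, ← hpD b hb, he] at this
        exact absurd this (lt_irrefl _)
      · exact hd ha hb h
      · have := hg b hb a ha h
        rw [← hpD a ha, ← hpD b hb, he] at this
        exact absurd this (lt_irrefl _)
    · exact absurd he (hne a ha b hb)
    · exact absurd he.symm (hne b hb a ha)
    · rw [hpq a ha, hpq b hb] at he
      exact hq (by simpa using ha) (by simpa using hb) he
  refine ⟨Equiv.ofBijective p (Finite.injective_iff_bijective.1 hinj), hpq, ?_⟩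
  intro a ha b hb hab
  change p a < p b
  rw [hpD a ha, hpD b hb]
  exact hg a ha b hb hab

/-- Every combinatorial Ish ceiling diagram is the diagram of a region. -/
theorem exists_ish_region {n : ℕ} [NeZero n] (p : Equiv.Perm (Fin n)) (d : Fin n → ℕ)
    (hd0 : d 0 = 0) (hdle : ∀ i, d i ≤ i)
    (hp : ∀ a b, (a = 0 ∨ d a ≠ 0) → d a < d b → p a < p b)
    (hinj : ∀ a b, d a ≠ 0 → d a = d b → a = b) :
    ∃ R : Region (ish n), ishPerm R = p.symm ∧ letterDots R = d := by
  classical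
  -- `e j` will be the least number of dots at or to the right of `j`, that is, the first integer
  -- wall above `x 0 - x j`. The default `n + 1` exceeds every Ish constant.
  let E : Fin n → Finset ℕ := fun j =>
    insert (n + 1) ((univ.filter fun l => d l ≠ 0 ∧ p j ≤ p l).image d)
  have hE : ∀ j, (E j).Nonempty := fun j => insert_nonempty _ _
  let e : Fin n → ℕ := fun j => (E j).min' (hE j)
  have he_le : ∀ j l, d l ≠ 0 → p j ≤ p l → e j ≤ d l := fun j l h1 h2 =>
    min'_le _ _ (mem_insert_of_mem (mem_image_of_mem d (by simp [h1, h2])))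
  have he_cases : ∀ j, e j = n + 1 ∨ ∃ l, d l ≠ 0 ∧ p j ≤ p l ∧ e j = d l := by
    intro j
    have h1 : e j ∈ E j := min'_mem _ _
    rcases mem_insert.1 h1 with h2 | h2
    · exact Or.inl h2
    · obtain ⟨l, hl, hle⟩ := mem_image.1 h2
      rw [mem_filter] at hl
      exact Or.inr ⟨l, hl.2.1, hl.2.2, hle.symm⟩
  have he_mono : ∀ a b, p a ≤ p b → e a ≤ e b := by
    intro a b hab
    rcases he_cases b with h | ⟨l, h1, h2, h3⟩
    · rw [h]
      exact min'_le _ _ (mem_insert_self _ _)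
    · rw [h3]
      exact he_le a l h1 (hab.trans h2)
  have he_pos : ∀ j, 1 ≤ e j := by
    intro j
    rcases he_cases j with h | ⟨l, h1, h2, h3⟩ <;> omega
  let fr : Fin n → ℝ := fun j => ((p j : ℕ) + 1 : ℝ) / (n + 1)
  have hn : (0 : ℝ) < n + 1 := by positivity
  have hfr0 : ∀ j, 0 < fr j := fun j => by positivity
  have hfr1 : ∀ j, fr j < 1 := by
    intro j
    simp only [fr]
    rw [div_lt_one hn]
    have : ((p j : ℕ) : ℝ) < n := by exact_mod_cast (p j).2
    linarith
  have hfr : ∀ a b, p a < p b → fr a < fr b := by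
    intro a b hab
    have : ((p a : ℕ) : ℝ) < (p b : ℕ) := by exact_mod_cast hab
    exact div_lt_div_of_pos_right (by linarith) hn
  -- Letters right of 1 get `x 0 - x j` in `(e j - 1, e j)`, with ties in `e` broken by position;
  -- letters left of 1 get negative values.
  let v : Fin n → ℝ := fun j => if p 0 < p j then (e j : ℝ) - 1 + fr j
    else ((p j : ℕ) : ℝ) - (p 0 : ℕ)
  have hv0 : v 0 = 0 := by simp [v]
  have hvr : ∀ j, p 0 < p j → v j = (e j : ℝ) - 1 + fr j := fun j hj => if_pos hj
  have hvl : ∀ j, ¬ p 0 < p j → v j ≤ 0 := by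
    intro j hj
    simp only [v, if_neg hj]
    have : ((p j : ℕ) : ℝ) ≤ (p 0 : ℕ) := by exact_mod_cast not_lt.1 hj
    linarith
  have hvpos : ∀ j, p 0 < p j → 0 < v j := by
    intro j hj
    rw [hvr j hj]
    have : (1 : ℝ) ≤ e j := by exact_mod_cast he_pos j
    linarith [hfr0 j]
  have hvmono : ∀ a b, p a < p b → v a < v b := by
    intro a b hab
    by_cases ha : p 0 < p a
    · rw [hvr a ha, hvr b (ha.trans hab)]
      have : (e a : ℝ) ≤ e b := by exact_mod_cast he_mono a b hab.le
      linarith [hfr a b hab]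
    · by_cases hb : p 0 < p b
      · exact (hvl a ha).trans_lt (hvpos b hb)
      · simp only [v, if_neg ha, if_neg hb]
        have : ((p a : ℕ) : ℝ) < (p b : ℕ) := by exact_mod_cast hab
        linarith
  have hvlt : ∀ j (i : ℕ), p 0 < p j → (v j < (i : ℝ) + 1 ↔ e j ≤ i + 1) := by
    intro j i hj
    rw [hvr j hj]
    constructor
    · intro h
      by_contra hlt
      have : ((i : ℝ) + 1) + 1 ≤ e j := by exact_mod_cast not_le.1 hlt
      linarith [hfr0 j]
    · intro h
      have : (e j : ℝ) ≤ i + 1 := by exact_mod_cast h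
      linarith [hfr1 j]
  have hvgt : ∀ j (i : ℕ), p 0 < p j → ((i : ℝ) + 1 < v j ↔ i + 1 < e j) := by
    intro j i hj
    rw [hvr j hj]
    constructor
    · intro h
      by_contra hlt
      have : (e j : ℝ) ≤ i + 1 := by exact_mod_cast not_lt.1 hlt
      linarith [hfr1 j]
    · intro h
      have : ((i : ℝ) + 1) + 1 ≤ e j := by exact_mod_cast h
      linarith [hfr0 j]
  let x : Fin n → ℝ := fun j => -v j
  have hx0 : ∀ j, x 0 - x j = v j := fun j => by simp [x, hv0]
  have hxlt : ∀ a b, x b < x a ↔ p a < p b := by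
    intro a b
    simp only [x, neg_lt_neg_iff]
    refine ⟨fun h => ?_, hvmono a b⟩
    by_contra hne
    rcases (not_lt.1 hne).eq_or_lt with h1 | h1
    · rw [p.injective h1] at h
      exact lt_irrefl _ h
    · exact lt_asymm h (hvmono b a h1)
  have hxc : x ∈ complement (ish n) := by
    rintro K (⟨a, b, hab, rfl⟩ | ⟨i, j, hij, rfl⟩) hK
    · rw [mem_diffHyperplane, sub_eq_zero] at hK
      rcases lt_or_gt_of_ne (p.injective.ne hab.ne) with h | h
      · exact ((hxlt a b).2 h).ne hK.symm
      · exact ((hxlt b a).2 h).ne hK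
    · rw [mem_diffHyperplane, hx0] at hK
      by_cases hj : p 0 < p j
      · have h1 := (hvlt j i hj).not.1 hK.not_lt
        have h2 := (hvgt j i hj).not.1 hK.not_gt
        omega
      · have := hvl j hj
        have : (0 : ℝ) ≤ i := by positivity
        linarith
  obtain ⟨R, hxR⟩ := exists_region_of_mem hxc
  have hceil : ∀ i l : Fin n, i < l →
      (IsCeiling (ish n) R.1 (diffHyperplane 0 l ((i : ℝ) + 1)) ↔ d l = i + 1) := by
    intro i l hil
    rw [ish_isCeiling_iff R hxR hil, hx0]
    constructor
    · rintro ⟨h1, h2, h3⟩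
      have hl : p 0 < p l := by
        by_contra hl
        have := hvl l hl
        have : (0 : ℝ) ≤ i := by positivity
        linarith
      have h4 := (hvlt l i hl).1 h1
      have h5 : (i : ℕ) < e l := by
        rcases Nat.eq_zero_or_pos (i : ℕ) with h0 | h0
        · have := he_pos l
          omega
        · have h6 : (((i : ℕ) - 1 : ℕ) : ℝ) + 1 = i := by
            exact_mod_cast Nat.sub_add_cancel h0
          have := (hvgt l (i - 1) hl).1 (by rw [h6]; exact h2)
          omega
      have hil' : (i : ℕ) < l := hil
      rcases he_cases l with h6 | ⟨k, hk1, hk2, hk3⟩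
      · have := l.2
        omega
      -- The letter attaining `e l` must be `l` itself: one further right would lie below the same
      -- wall and stop it from being a ceiling of `l`.
      · rcases hk2.eq_or_lt with h7 | h7
        · rw [p.injective h7]
          omega
        · exfalso
          have h8 := h3 k (by have := hdle k; simp only [Fin.lt_def]; omega) ((hxlt l k).2 h7)
          rw [hx0, hvgt k i (hl.trans h7)] at h8
          have := he_le k k hk1 le_rfl
          omega
    · intro h
      have hl : p 0 < p l := hp 0 l (Or.inl rfl) (by omega)
      have hel : e l = i + 1 := by
        refine le_antisymm (h ▸ he_le l l (by omega) le_rfl) ?_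
        rcases he_cases l with h1 | ⟨k, hk1, hk2, hk3⟩
        · have := i.2
          omega
        · by_contra hlt
          exact hk2.not_gt (hp k l (Or.inr hk1) (by omega))
      refine ⟨(hvlt l i hl).2 hel.le, ?_, ?_⟩
      · rw [hvr l hl, hel]
        push_cast
        linarith [hfr0 l]
      · intro j hij hjl
        rw [hxlt] at hjl
        rw [hx0, hvgt j i (hl.trans hjl)]
        rcases he_cases j with h1 | ⟨k, hk1, hk2, hk3⟩
        · have := i.2
          omega
        · by_contra hle
          rw [hk3, not_lt, ← h] at hle
          rcases hle.eq_or_lt with h2 | h2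
          · rw [hinj k l hk1 h2] at hk2
            exact hk2.not_gt hjl
          · exact (hk2.trans_lt (hp k l (Or.inr hk1) h2)).not_gt hjl
  have hdiag : IsIshDiagram R.1 p.symm (fun k => d (p.symm k)) := by
    obtain ⟨π, hπ, -⟩ := exists_isOrder (cox_subset_ish n) R
    refine ⟨?_, fun k i hi hc => (hceil i _ hi).1 hc, ?_⟩
    · intro y hy a b hab
      rw [hπ.sub_pos_iff hy, ← hπ.sub_pos_iff hxR, hxlt]
      simpa using hab
    · intro k hk
      by_contra hne
      have h1 := hdle (p.symm k)
      refine hk ⟨d (p.symm k) - 1, by omega⟩ ?_ ((hceil _ _ ?_).2 ?_) <;>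
        (simp only [Fin.lt_def]; omega)
  have huniq := (exists_isIshDiagram R).choose_spec.2 (p.symm, fun k => d (p.symm k)) hdiag
  have hperm : ishPerm R = p.symm := (congrArg Prod.fst huniq).symm
  refine ⟨R, hperm, funext fun j => ?_⟩
  have hdots : ishDots R = fun k => d (p.symm k) := (congrArg Prod.snd huniq).symm
  simp only [letterDots, hdots, hperm]
  simp

theorem rho_surjective (n : ℕ) [NeZero n] : Function.Surjective (rho n) := by
  rintro ⟨P, hP⟩
  obtain ⟨h, hh, rfl⟩ := exists_height hP
  have hcol : ∀ i : Fin n, i ≠ 0 → (i : ℕ) + 1 ∈ Icc 2 n := by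
    intro i hi
    have hi0 : (i : ℕ) ≠ 0 := fun h0 => hi (Fin.ext (by simpa using h0))
    exact mem_Icc.2 ⟨by omega, i.2⟩
  -- Truncated subtraction gives zero dots exactly when the rook stands at height at most `n`.
  let d : Fin n → ℕ := fun i => if i = 0 then 0 else h (i + 1) - n
  have hd0 : d 0 = 0 := by simp [d]
  have hdne : ∀ i, i ≠ 0 → d i = h (i + 1) - n := fun i hi => if_neg hi
  have hdinj : ∀ a b, d a ≠ 0 → d a = d b → a = b := by
    intro a b ha hab
    have ha0 : a ≠ 0 := fun h0 => ha (by rw [h0, hd0])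
    have hb0 : b ≠ 0 := fun h0 => ha (by rw [hab, h0, hd0])
    rw [hdne a ha0] at ha hab
    rw [hdne b hb0] at hab
    have := hh.inj _ (hcol a ha0) _ (hcol b hb0) (by omega)
    exact Fin.ext (by omega)
  let D : Finset (Fin n) := univ.filter fun i => i = 0 ∨ d i ≠ 0
  have hD : ∀ i, i ∈ D ↔ i = 0 ∨ d i ≠ 0 := fun i => by simp [D]
  have hq : ∀ i, i ∉ D → i ≠ 0 ∧ 1 ≤ h (i + 1) ∧ h (i + 1) ≤ n := by
    intro i hi
    rw [hD] at hi
    push Not at hi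
    have h1 := hi.2
    rw [hdne i hi.1] at h1
    exact ⟨hi.1, hh.pos _ (hcol i hi.1), by omega⟩
  have hn : 0 < n := Nat.pos_of_ne_zero (NeZero.ne n)
  -- The reduction modulo `n` only makes `q` total; for letters outside `D` it changes nothing.
  let q : Fin n → Fin n := fun i => ⟨(h (i + 1) - 1) % n, Nat.mod_lt _ hn⟩
  have hqv : ∀ i, i ∉ D → (q i : ℕ) = h (i + 1) - 1 := by
    intro i hi
    have := hq i hi
    exact Nat.mod_eq_of_lt (by omega)
  obtain ⟨p, hpq, hpd⟩ := exists_perm_extending D d (by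
      intro a ha b hb hab
      rw [mem_coe, hD] at ha hb
      by_cases h0 : d a = 0
      · rw [ha.resolve_right (not_not.2 h0), hb.resolve_right (not_not.2 (hab ▸ h0))]
      · exact hdinj a b h0 hab) q (by
      intro a ha b hb hab
      have ha' : a ∉ D := by simpa using ha
      have hb' : b ∉ D := by simpa using hb
      have h1 := congrArg Fin.val hab
      rw [hqv a ha', hqv b hb'] at h1
      have h2 := hq a ha'
      have h3 := hq b hb'
      have := hh.inj _ (hcol a h2.1) _ (hcol b h3.1) (by omega)
      exact Fin.ext (by omega))
  obtain ⟨R, hR1, hR2⟩ := exists_ish_region p d hd0 (by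
      intro i
      by_cases hi : i = 0
      · rw [hi, hd0]
        exact Nat.zero_le _
      · rw [hdne i hi]
        have := hh.le _ (hcol i hi)
        omega) (fun a b ha hab => hpd a ((hD a).2 ha) b ((hD b).2 (Or.inr (by omega))) hab) hdinj
  refine ⟨R, Subtype.ext (rho_val R fun i hi => ?_)⟩
  rw [rookHeight_eq, hR1, hR2, Equiv.symm_symm]
  split_ifs with h0
  · have hiD : i ∉ D := fun h1 => ((hD i).1 h1).elim hi fun h2 => h2 h0
    have := hq i hiD
    rw [hpq i hiD, hqv i hiD]
    omega
  · rw [hdne i hi] at h0 ⊢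
    omega

theorem rho_bijective (n : ℕ) [NeZero n] : Function.Bijective (rho n) :=
  ⟨rho_injective n, rho_surjective n⟩

/-! ### Shi regions -/

theorem shi_finite (n : ℕ) : (shi n).Finite := by
  refine ((Set.finite_range fun q : Fin n × Fin n => diffHyperplane q.1 q.2 0).union
    (Set.finite_range fun q : Fin n × Fin n => diffHyperplane q.1 q.2 1)).subset ?_
  rintro H (⟨i, j, -, rfl⟩ | ⟨i, j, -, rfl⟩)
  · exact Or.inl ⟨(i, j), rfl⟩
  · exact Or.inr ⟨(i, j), rfl⟩

theorem mem_shi_iff {n : ℕ} {i j : Fin n} : diffHyperplane i j 1 ∈ shi n ↔ i < j := by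
  refine ⟨?_, fun h => Or.inr ⟨i, j, h, rfl⟩⟩
  rintro (⟨a, b, hab, he⟩ | ⟨a, b, hab, he⟩)
  · rcases diffHyperplane_le hab.ne he.ge with h | h | h
    · exact absurd h.2 one_ne_zero
    · exact absurd h.2.2 one_ne_zero
    · exact absurd h.2.2 (by norm_num)
  · rcases diffHyperplane_le hab.ne he.ge with h | h | h
    · exact absurd h.2 one_ne_zero
    · rw [h.1, h.2.1]
      exact hab
    · exact absurd h.2.2 (by norm_num)

theorem shi_sub_ne {n : ℕ} {x : Fin n → ℝ} (hx : x ∈ complement (shi n)) {i j : Fin n}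
    (h : i < j) : x i - x j ≠ 1 := fun he => hx _ (mem_shi_iff.2 h) he

/-! ### Points with prescribed order and close pairs -/

/-- Unit interval representation of the semiorder given by a monotone function `f`. -/
theorem exists_unit_interval_representation {f : ℕ → ℕ} (hf : Monotone f) (N : ℕ) :
    ∃ y : ℕ → ℝ, ∀ a b, a < b → b < N →
      y a < y b ∧ (b ≤ f a → y b < y a + 1) ∧ (f a < b → y a + 1 < y b) := by
  induction N with
  | zero => exact ⟨0, by omega⟩
  | succ N ih =>
    obtain ⟨y, hy⟩ := ih
    -- The new point must exceed the earlier points and the right ends of intervals that should miss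
    -- it, and stay below the other right ends. Monotonicity of `f` makes these bounds compatible.
    obtain ⟨m, hlo, hhi⟩ := Order.exists_between_finsets
      ((range N).image y ∪ ((range N).filter fun a => f a < N).image fun a => y a + 1)
      (((range N).filter fun a => N ≤ f a).image fun a => y a + 1) (by
        intro l hl u hu
        obtain ⟨b, hb, rfl⟩ := mem_image.1 hu
        rw [mem_filter, mem_range] at hb
        rcases mem_union.1 hl with hl | hl
        · obtain ⟨a, ha, rfl⟩ := mem_image.1 hl
          rw [mem_range] at ha
          rcases lt_trichotomy a b with h | rfl | h
          · linarith [(hy a b h hb.1).1]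
          · linarith
          · exact (hy b a h ha).2.1 (by omega)
        · obtain ⟨a, ha, rfl⟩ := mem_image.1 hl
          rw [mem_filter, mem_range] at ha
          have hab : a < b := by
            by_contra hba
            have := hf (not_lt.1 hba)
            omega
          linarith [(hy a b hab hb.1).1])
    refine ⟨Function.update y N m, fun a b hab hb => ?_⟩
    rw [Function.update_of_ne (by omega : a ≠ N)]
    rcases (Nat.lt_succ_iff.1 hb).eq_or_lt with rfl | hlt
    · rw [Function.update_self]
      refine ⟨?_, fun h => ?_, fun h => ?_⟩
      · exact hlo _ (mem_union_left _ (mem_image_of_mem _ (mem_range.2 hab)))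
      · exact hhi _ (mem_image_of_mem (fun a => y a + 1) (mem_filter.2 ⟨mem_range.2 hab, h⟩))
      · exact hlo _ (mem_union_right _ (mem_image_of_mem (fun a => y a + 1)
          (mem_filter.2 ⟨mem_range.2 hab, h⟩)))
    · rw [Function.update_of_ne hlt.ne]
      exact hy a b hab hlt

/-- Every order of the coordinates together with an order ideal of close pairs is realized by a
point. -/
theorem exists_shi_point {n : ℕ} (p : Equiv.Perm (Fin n)) (C : Fin n → Fin n → Prop)
    (hC : ∀ i j i' j', i < j → p i < p j → i' < j' → p i' < p j' → C i' j' → p i' ≤ p i →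
      p j ≤ p j' → C i j) :
    ∃ x ∈ complement (shi n), (∀ i j, x j < x i ↔ p i < p j) ∧
      ∀ i j, i < j → p i < p j → (x i - x j < 1 ↔ C i j) := by
  classical
  let S : ℕ → Finset (Fin n × Fin n) := fun a =>
    {s | s.1 < s.2 ∧ p s.1 < p s.2 ∧ C s.1 s.2 ∧ (p s.1 : ℕ) ≤ a}
  -- `f a` is the furthest position reached by a close pair that starts at or before `a`; the order
  -- ideal property makes closeness equivalent to lying within this reach.
  let f : ℕ → ℕ := fun a => (S a).sup fun s => (p s.2 : ℕ)
  have hf : Monotone f := by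
    intro a b hab
    refine sup_mono fun s hs => ?_
    simp only [S, mem_filter, mem_univ, true_and] at hs ⊢
    exact ⟨hs.1, hs.2.1, hs.2.2.1, hs.2.2.2.trans hab⟩
  have hfC : ∀ i j, i < j → p i < p j → ((p j : ℕ) ≤ f (p i) ↔ C i j) := by
    intro i j hij hp
    constructor
    · intro h
      have h0 : 0 < (p j : ℕ) := lt_of_le_of_lt (Nat.zero_le _) hp
      obtain ⟨s, hs, hle⟩ := (Finset.le_sup_iff h0).1 h
      simp only [S, mem_filter, mem_univ, true_and] at hs
      exact hC i j s.1 s.2 hij hp hs.1 hs.2.1 hs.2.2.1 hs.2.2.2 hle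
    · intro h
      exact Finset.le_sup (f := fun s : Fin n × Fin n => (p s.2 : ℕ)) (b := (i, j))
        (by simp [S, hij, hp, h])
  obtain ⟨y, hy⟩ := exists_unit_interval_representation hf n
  have hylt : ∀ i j, p i < p j → y (p i) < y (p j) := fun i j h => (hy _ _ h (p j).2).1
  have hxlt : ∀ i j : Fin n, -y (p j) < -y (p i) ↔ p i < p j := by
    intro i j
    rw [neg_lt_neg_iff]
    refine ⟨fun h => ?_, hylt i j⟩
    by_contra hne
    rcases (not_lt.1 hne).eq_or_lt with h1 | h1
    · rw [h1] at h
      exact lt_irrefl _ h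
    · exact lt_asymm h (hylt j i h1)
  refine ⟨fun i => -y (p i), ?_, hxlt, ?_⟩
  · rintro K (⟨a, b, hab, rfl⟩ | ⟨a, b, hab, rfl⟩) hK <;> rw [mem_diffHyperplane] at hK
    · rcases lt_or_gt_of_ne (p.injective.ne hab.ne) with h | h
      · linarith [hylt a b h]
      · linarith [hylt b a h]
    · rcases lt_or_gt_of_ne (p.injective.ne hab.ne) with h | h
      · rcases le_or_gt ((p b : Fin n) : ℕ) (f (p a)) with h2 | h2
        · linarith [(hy _ _ h (p b).2).2.1 h2]
        · linarith [(hy _ _ h (p b).2).2.2 h2]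
      · linarith [hylt b a h]
  · intro i j hij hp
    rw [← hfC i j hij hp]
    constructor
    · intro h
      by_contra hlt
      linarith [(hy _ _ hp (p j).2).2.2 (not_le.1 hlt)]
    · intro h
      linarith [(hy _ _ hp (p j).2).2.1 h]

theorem shiPerm_isOrder {n : ℕ} (R : Region (shi n)) : IsOrder R.1 (shiPerm R) :=
  (exists_isOrder (cox_subset_shi n) R).choose_spec.1

theorem shiPerm_lt_iff {n : ℕ} (R : Region (shi n)) {x : Fin n → ℝ} (hx : x ∈ R.1)
    (i j : Fin n) : x j < x i ↔ (shiPerm R).symm i < (shiPerm R).symm j :=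
  (shiPerm_isOrder R).sub_pos_iff hx i j

theorem shiPerm_le_iff {n : ℕ} (R : Region (shi n)) {x : Fin n → ℝ} (hx : x ∈ R.1)
    (i j : Fin n) : x j ≤ x i ↔ (shiPerm R).symm i ≤ (shiPerm R).symm j := by
  rw [← not_lt, shiPerm_lt_iff R hx, not_lt]

/-- The ceilings of a Shi region, read off from any of its points. -/
theorem shi_isCeiling_iff {n : ℕ} (R : Region (shi n)) {x : Fin n → ℝ} (hx : x ∈ R.1)
    {i j : Fin n} : IsCeiling (shi n) R.1 (diffHyperplane i j 1) ↔
      i < j ∧ x j < x i ∧ x i - x j < 1 ∧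
        ∀ i' j', i' < j' → x i ≤ x i' → x j' ≤ x j → x i' - x j' < 1 → i' = i ∧ j' = j := by
  have hxc := R.subset hx
  have hinj := injective_of_mem_complement (cox_subset_shi n) hxc
  constructor
  · intro h
    have hij : i < j := mem_shi_iff.1 h.1
    refine ⟨hij, ?_, h.sub_lt one_pos hx, ?_⟩
    · by_contra hle
      refine h.not_sub_lt hij.ne one_pos fun y hy => ?_
      linarith [R.le_of_le (cox_subset_shi n) hx (not_lt.1 hle) y hy]
    · intro i' j' hij' hi hj hlt
      -- A close pair enclosing `(i, j)` has difference at most 1 on the region, so on the facet its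
      -- endpoints would coincide with those of `(i, j)`.
      have h1 := R.sub_le_of_le (mem_shi_iff.2 hij') hx hlt.le
      have h2 := R.le_of_le (cox_subset_shi n) hx hi
      have h3 := R.le_of_le (cox_subset_shi n) hx hj
      have hcl : ∀ z ∈ closure R.1, z ∈ diffHyperplane i j 1 → z i' - z i = 0 ∧ z j' - z j = 0 := by
        intro z hz hzH
        have q1 := closure_sub_le h1 hz
        have q2 := closure_sub_le (i := i) (j := i') (c := 0)
          (fun y hy => by linarith [h2 y hy]) hz
        have q3 := closure_sub_le (i := j') (j := j) (c := 0)
          (fun y hy => by linarith [h3 y hy]) hz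
        rw [mem_diffHyperplane] at hzH
        constructor <;> linarith
      have k1 : diffHyperplane i j 1 ≤ diffHyperplane i' i 0 :=
        h.eq_of_facet fun z hz hzH => (hcl z hz hzH).1
      have k2 : diffHyperplane i j 1 ≤ diffHyperplane j' j 0 :=
        h.eq_of_facet fun z hz hzH => (hcl z hz hzH).2
      constructor
      · rcases diffHyperplane_le hij.ne k1 with h4 | h4 | h4
        · exact h4.1
        · exact absurd h4.2.1 hij.ne
        · exact absurd h4.2.2 (by norm_num)
      · rcases diffHyperplane_le hij.ne k2 with h4 | h4 | h4
        · exact h4.1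
        · exact absurd h4.2.2 (by norm_num)
        · exact absurd h4.2.1 hij.ne'
  · rintro ⟨hij, hji, hlt, hmax⟩
    -- Deleting a maximal close pair leaves an order ideal; a point realizing it is separated from
    -- `x` by this wall alone.
    obtain ⟨x', hx'c, hord, hclose⟩ := exists_shi_point (shiPerm R).symm
      (fun a b => x a - x b < 1 ∧ ¬ (a = i ∧ b = j)) (by
        rintro a b a' b' hab - hab' - ⟨h1, h2⟩ h3 h4
        rw [← shiPerm_le_iff R hx] at h3 h4
        refine ⟨by linarith, ?_⟩
        rintro ⟨rfl, rfl⟩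
        exact h2 (hmax a' b' hab' h3 h4 h1))
    have hord' : ∀ a b, x b < x a ↔ x' b < x' a := fun a b => by
      rw [hord, shiPerm_lt_iff R hx]
    refine isCeiling_of_adjacent (shi_finite n) R one_pos (mem_shi_iff.2 hij) (x' := x') hx hlt
      ?_ ?_
    · refine lt_of_le_of_ne (not_lt.1 fun h => ?_) (shi_sub_ne hx'c hij).symm
      exact ((hclose i j hij ((shiPerm_lt_iff R hx _ _).1 hji)).1 h).2 ⟨rfl, rfl⟩
    · rintro K (⟨a, b, hab, rfl⟩ | ⟨a, b, hab, rfl⟩) hne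
      · exact ⟨a, b, 0, rfl, sameSide_zero_of_lt_iff hinj hord' hab.ne⟩
      · refine ⟨a, b, 1, rfl, SameSide.of_lt_iff (shi_sub_ne hxc hab) (shi_sub_ne hx'c hab) ?_⟩
        by_cases hp : (shiPerm R).symm a < (shiPerm R).symm b
        · rw [hclose a b hab hp]
          refine ⟨fun h => ⟨h, ?_⟩, fun h => h.1⟩
          rintro ⟨rfl, rfl⟩
          exact hne rfl
        · have h1 : x a < x b := (shiPerm_lt_iff R hx _ _).2 (lt_of_le_of_ne (not_lt.1 hp)
            ((shiPerm R).symm.injective.ne hab.ne'))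
          have h2 := (hord' b a).1 h1
          constructor <;> intro <;> linarith

/-! ### Words of Shi regions and reconstruction -/

/-- `j` is the next larger index after `i` carrying the same letter of `w`. -/
def IsNext {n : ℕ} (w : Fin n → ℕ) (i j : Fin n) : Prop :=
  i < j ∧ w i = w j ∧ ∀ l, i < l → l < j → w l ≠ w i

theorem exists_isNext_left {n : ℕ} {w : Fin n → ℕ} {l j : Fin n} (hlj : l < j)
    (hw : w l = w j) : ∃ i, IsNext w i j := by
  obtain ⟨i, hi, hmax⟩ := (univ.filter fun i => i < j ∧ w i = w j).exists_max_image id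
    ⟨l, by simp [hlj, hw]⟩
  rw [mem_filter] at hi
  refine ⟨i, hi.2.1, hi.2.2, fun k hik hkj he => ?_⟩
  exact (hmax k (by simp [hkj, he, hi.2.2])).not_gt hik

theorem IsNext.right_unique {n : ℕ} {w : Fin n → ℕ} {i j j' : Fin n} (h : IsNext w i j)
    (h' : IsNext w i j') : j = j' := by
  rcases lt_trichotomy j j' with hlt | he | hlt
  · exact absurd h.2.1.symm (h'.2.2 j h.1 hlt)
  · exact he
  · exact absurd h'.2.1.symm (h.2.2 j' h'.1 hlt)

/-- The combinatorial description of the pairs (order of the coordinates, word) coming from Shi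
regions: the first index carrying a letter sits at the position given by this letter, and the
arcs joining consecutive indices with equal letters point to the right and do not nest. -/
structure IsShiOrder {n : ℕ} (w : Fin n → ℕ) (p : Equiv.Perm (Fin n)) : Prop where
  first : ∀ i, (∀ l, l < i → w l ≠ w i) → w i = (p i : ℕ) + 1
  lt : ∀ i j, IsNext w i j → p i < p j
  nonnesting : ∀ i j i' j', IsNext w i j → IsNext w i' j' → p i < p i' → p j < p j'

/-- A first occurrence has its position dictated by its letter. Two other candidates for the same
position have predecessors placed earlier, and non-nesting makes the one with the earlier
predecessor come first. -/
theorem IsShiOrder.eq {n : ℕ} {w : Fin n → ℕ} {p p' : Equiv.Perm (Fin n)} (h : IsShiOrder w p)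
    (h' : IsShiOrder w p') : p = p' := by
  refine eq_of_first_difference fun i i' hii hag => ?_
  by_cases hi : ∀ l, l < i → w l ≠ w i
  · have h1 : p i = p' i := Fin.ext (by have := h.first i hi; have := h'.first i hi; omega)
    exact p'.injective (h1.symm.trans hii)
  by_cases hi' : ∀ l, l < i' → w l ≠ w i'
  · have h1 : p i' = p' i' := Fin.ext (by have := h.first i' hi'; have := h'.first i' hi'; omega)
    exact p.injective (hii.trans h1.symm)
  push Not at hi hi'
  obtain ⟨l, hl, hlw⟩ := hi
  obtain ⟨l', hl', hlw'⟩ := hi'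
  obtain ⟨a, ha⟩ := exists_isNext_left hl hlw
  obtain ⟨a', ha'⟩ := exists_isNext_left hl' hlw'
  have q1 : p a < p i := h.lt _ _ ha
  have q2 : p' a' < p i := hii ▸ h'.lt _ _ ha'
  have e1 := hag a (Or.inl q1)
  have e2 := hag a' (Or.inr q2)
  rcases lt_trichotomy (p a) (p a') with hlt | heq | hlt
  · have h1 := h'.nonnesting _ _ _ _ ha ha' (by rwa [← e1, ← e2])
    rw [← hii] at h1
    rw [← hag i (Or.inr h1)] at h1
    exact absurd h1 (lt_irrefl _)
  · rw [p.injective heq] at ha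
    exact ha.right_unique ha'
  · have h1 := h.nonnesting _ _ _ _ ha' ha hlt
    rw [hag i' (Or.inl h1), hii] at h1
    exact absurd h1 (lt_irrefl _)

/-- With at most one arc into and one arc out of each point, the generated classes are chains. -/
theorem eqvGen_total {α : Type*} {r : α → α → Prop} (hr : Relator.RightUnique r)
    (hl : Relator.LeftUnique r) {a b : α} (h : Relation.EqvGen r a b) :
    Relation.ReflTransGen r a b ∨ Relation.ReflTransGen r b a := by
  induction h with
  | rel a b h => exact Or.inl (.single h)
  | refl a => exact Or.inl .refl
  | symm a b _ ih => exact ih.symm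
  | trans a b c _ _ ih1 ih2 =>
    rcases ih1 with h1 | h1 <;> rcases ih2 with h2 | h2
    · exact Or.inl (h1.trans h2)
    · have hsw : Relator.RightUnique (Function.swap r) := fun _ _ _ h h' => hl h h'
      have := Relation.ReflTransGen.total_of_right_unique hsw
        (Relation.reflTransGen_swap.2 h1) (Relation.reflTransGen_swap.2 h2)
      exact (this.imp Relation.reflTransGen_swap.1 Relation.reflTransGen_swap.1).symm
    · exact Relation.ReflTransGen.total_of_right_unique hr h1 h2
    · exact Or.inr (h2.trans h1)

/-- Of two close pairs with a common endpoint, one encloses the other, so both can be maximal only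
if they are equal. -/
theorem shi_isCeiling_right_unique {n : ℕ} (R : Region (shi n)) {i j j' : Fin n}
    (h : IsCeiling (shi n) R.1 (diffHyperplane i j 1))
    (h' : IsCeiling (shi n) R.1 (diffHyperplane i j' 1)) : j = j' := by
  obtain ⟨x, hx⟩ := R.nonempty
  rw [shi_isCeiling_iff R hx] at h h'
  rcases le_total (x j) (x j') with hle | hle
  · exact (h'.2.2.2 i j h.1 le_rfl hle h.2.2.1).2
  · exact (h.2.2.2 i j' h'.1 le_rfl hle h'.2.2.1).2.symm

theorem shi_isCeiling_left_unique {n : ℕ} (R : Region (shi n)) {i i' j : Fin n}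
    (h : IsCeiling (shi n) R.1 (diffHyperplane i j 1))
    (h' : IsCeiling (shi n) R.1 (diffHyperplane i' j 1)) : i = i' := by
  obtain ⟨x, hx⟩ := R.nonempty
  rw [shi_isCeiling_iff R hx] at h h'
  rcases le_total (x i) (x i') with hle | hle
  · exact (h.2.2.2 i' j h'.1 hle le_rfl h'.2.2.1).1.symm
  · exact (h'.2.2.2 i j h.1 hle le_rfl h.2.2.1).1

/-- The relation on positions generating `shiPartition R`. -/
def ShiArc {n : ℕ} (R : Region (shi n)) (a b : Fin n) : Prop :=
  IsCeiling (shi n) R.1 (diffHyperplane (shiPerm R a) (shiPerm R b) 1)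

theorem ShiArc.lt {n : ℕ} {R : Region (shi n)} {a b : Fin n} (h : ShiArc R a b) :
    a < b ∧ shiPerm R a < shiPerm R b := by
  obtain ⟨x, hx⟩ := R.nonempty
  obtain ⟨h1, h2, -⟩ := (shi_isCeiling_iff R hx).1 h
  rw [shiPerm_lt_iff R hx] at h2
  exact ⟨by simpa using h2, h1⟩

theorem shiArc_right_unique {n : ℕ} (R : Region (shi n)) : Relator.RightUnique (ShiArc R) :=
  fun _ _ _ h h' => (shiPerm R).injective (shi_isCeiling_right_unique R h h')

theorem shiArc_left_unique {n : ℕ} (R : Region (shi n)) : Relator.LeftUnique (ShiArc R) :=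
  fun _ _ _ h h' => (shiPerm R).injective (shi_isCeiling_left_unique R h h')

theorem shiArc_le {n : ℕ} {R : Region (shi n)} {a b : Fin n}
    (h : Relation.ReflTransGen (ShiArc R) a b) : a ≤ b ∧ shiPerm R a ≤ shiPerm R b := by
  induction h with
  | refl => exact ⟨le_rfl, le_rfl⟩
  | tail _ h ih => exact ⟨ih.1.trans h.lt.1.le, ih.2.trans h.lt.2.le⟩

theorem shiPartition_total {n : ℕ} (R : Region (shi n)) {a b : Fin n}
    (h : shiPartition R a b) :
    Relation.ReflTransGen (ShiArc R) a b ∨ Relation.ReflTransGen (ShiArc R) b a :=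
  eqvGen_total (shiArc_right_unique R) (shiArc_left_unique R) h

theorem shiWord_spec {n : ℕ} (R : Region (shi n)) (i : Fin n) :
    ∃ k : Fin n, shiWord R i = (k : ℕ) + 1 ∧ shiPartition R k ((shiPerm R).symm i) :=
  Nat.sInf_mem (s := {b : ℕ | ∃ k : Fin n, b = (k : ℕ) + 1 ∧
    shiPartition R k ((shiPerm R).symm i)}) ⟨_, _, rfl, (shiPartition R).refl _⟩

theorem shiWord_eq_iff {n : ℕ} (R : Region (shi n)) (i j : Fin n) : shiWord R i = shiWord R j ↔
    shiPartition R ((shiPerm R).symm i) ((shiPerm R).symm j) := by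
  constructor
  · intro h
    obtain ⟨k, hk, hki⟩ := shiWord_spec R i
    obtain ⟨l, hl, hlj⟩ := shiWord_spec R j
    obtain rfl : k = l := Fin.ext (by omega)
    exact (shiPartition R).trans ((shiPartition R).symm hki) hlj
  · intro h
    unfold shiWord
    congr 1
    ext b
    refine exists_congr fun k => and_congr_right fun _ => ?_
    exact ⟨fun hk => (shiPartition R).trans hk h,
      fun hk => (shiPartition R).trans hk ((shiPartition R).symm h)⟩

theorem shiWord_eq_position {n : ℕ} (R : Region (shi n)) {i : Fin n}
    (h : ∀ a, ¬ IsCeiling (shi n) R.1 (diffHyperplane a i 1)) :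
    shiWord R i = ((shiPerm R).symm i : ℕ) + 1 := by
  obtain ⟨k, hk, hki⟩ := shiWord_spec R i
  have hle : shiWord R i ≤ ((shiPerm R).symm i : ℕ) + 1 :=
    Nat.sInf_le ⟨_, rfl, (shiPartition R).refl _⟩
  rcases shiPartition_total R hki with h1 | h1
  · rcases h1.cases_tail with h2 | ⟨c, -, hc⟩
    · rw [hk, h2]
    · unfold ShiArc at hc
      rw [Equiv.apply_symm_apply] at hc
      exact absurd hc (h _)
  · have : ((shiPerm R).symm i : ℕ) ≤ k := (shiArc_le h1).1
    omega

theorem shiWord_eq_of_isCeiling {n : ℕ} (R : Region (shi n)) {i j : Fin n}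
    (h : IsCeiling (shi n) R.1 (diffHyperplane i j 1)) : shiWord R i = shiWord R j :=
  (shiWord_eq_iff R i j).2 (Relation.EqvGen.rel _ _ (by simpa using h))

/-- Letters increase along the chain of a block, so the arc leaving `i` goes to the next index with
the same word letter. The word thus records every ceiling. -/
theorem shi_isCeiling_iff_isNext {n : ℕ} (R : Region (shi n)) {i j : Fin n} :
    IsCeiling (shi n) R.1 (diffHyperplane i j 1) ↔ IsNext (shiWord R) i j := by
  have key : ∀ l, i < l → shiWord R i = shiWord R l →
      ∃ c, IsCeiling (shi n) R.1 (diffHyperplane i c 1) ∧ c ≤ l := by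
    intro l hil hw
    rcases shiPartition_total R ((shiWord_eq_iff R i l).1 hw) with h1 | h1
    · rcases h1.cases_head with h2 | ⟨c, hc, hcl⟩
      · exact absurd ((shiPerm R).symm.injective h2) hil.ne
      · refine ⟨shiPerm R c, ?_, ?_⟩
        · unfold ShiArc at hc
          rwa [Equiv.apply_symm_apply] at hc
        · simpa using (shiArc_le hcl).2
    · have := (shiArc_le h1).2
      rw [Equiv.apply_symm_apply, Equiv.apply_symm_apply] at this
      exact absurd this hil.not_ge
  constructor
  · intro h
    refine ⟨mem_shi_iff.1 h.1, shiWord_eq_of_isCeiling R h, fun l hil hlj hw => ?_⟩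
    obtain ⟨c, hc, hcl⟩ := key l hil hw.symm
    rw [← shi_isCeiling_right_unique R h hc] at hcl
    exact hcl.not_gt hlj
  · intro h
    obtain ⟨c, hc, hcj⟩ := key j h.1 h.2.1
    rcases hcj.eq_or_lt with rfl | hlt
    · exact hc
    · exact absurd (shiWord_eq_of_isCeiling R hc).symm (h.2.2 c (mem_shi_iff.1 hc.1) hlt)

theorem isShiOrder_shiWord {n : ℕ} (R : Region (shi n)) :
    IsShiOrder (shiWord R) (shiPerm R).symm := by
  obtain ⟨x, hx⟩ := R.nonempty
  refine ⟨fun i hi => shiWord_eq_position R fun a ha => ?_, fun i j hij => ?_,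
    fun i j i' j' hij hij' hlt => ?_⟩
  · exact hi a (mem_shi_iff.1 ha.1) (shiWord_eq_of_isCeiling R ha)
  · rw [← shi_isCeiling_iff_isNext, shi_isCeiling_iff R hx] at hij
    rw [← shiPerm_lt_iff R hx]
    exact hij.2.1
  · rw [← shi_isCeiling_iff_isNext, shi_isCeiling_iff R hx] at hij hij'
    rw [← shiPerm_lt_iff R hx] at hlt ⊢
    by_contra hle
    rw [(hij'.2.2.2 i j hij.1 hlt.le (not_lt.1 hle) hij.2.2.1).1] at hlt
    exact lt_irrefl _ hlt

theorem shi_sub_lt_iff {n : ℕ} (R : Region (shi n)) {x : Fin n → ℝ} (hx : x ∈ R.1)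
    {i j : Fin n} (hij : i < j) : x i - x j < 1 ↔
      (shiPerm R).symm j < (shiPerm R).symm i ∨ ∃ a b, IsNext (shiWord R) a b ∧
        (shiPerm R).symm a ≤ (shiPerm R).symm i ∧ (shiPerm R).symm j ≤ (shiPerm R).symm b := by
  simp only [← shiPerm_le_iff R hx, ← shiPerm_lt_iff R hx, ← shi_isCeiling_iff_isNext]
  have hinj := injective_of_mem_complement (cox_subset_shi n) (R.subset hx)
  constructor
  · intro h
    by_cases hji : x i < x j
    · exact Or.inl hji
    right
    have hji' : x j < x i := lt_of_le_of_ne (not_lt.1 hji) (hinj.ne hij.ne')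
    classical
    let S : Finset (Fin n × Fin n) :=
      {s | s.1 < s.2 ∧ x i ≤ x s.1 ∧ x s.2 ≤ x j ∧ x s.1 - x s.2 < 1}
    -- The widest close pair enclosing `(i, j)` is maximal, hence a ceiling.
    obtain ⟨⟨a, b⟩, hs, hmax⟩ := S.exists_max_image (fun s => x s.1 - x s.2)
      ⟨(i, j), by simp [S, hij, h]⟩
    simp only [S, mem_filter, mem_univ, true_and] at hs hmax
    obtain ⟨hab, h1, h2, h3⟩ := hs
    refine ⟨a, b, (shi_isCeiling_iff R hx).2 ⟨hab, by linarith, h3, ?_⟩, h1, h2⟩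
    intro a' b' hab' ha hb hlt
    have := hmax (a', b') ⟨hab', h1.trans ha, hb.trans h2, hlt⟩
    simp only at this
    exact ⟨hinj (by linarith), hinj (by linarith)⟩
  · rintro (h | ⟨a, b, hab, h1, h2⟩)
    · linarith
    · rw [shi_isCeiling_iff R hx] at hab
      linarith [hab.2.2.1]

theorem shiLabel_injective (n : ℕ) : Function.Injective (shiLabel n) := by
  intro R R' he
  have hw : shiWord R = shiWord R' := congrArg Subtype.val he
  have hp : (shiPerm R).symm = (shiPerm R').symm :=
    (isShiOrder_shiWord R).eq (hw ▸ isShiOrder_shiWord R')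
  obtain ⟨x, hx⟩ := R.nonempty
  obtain ⟨y, hy⟩ := R'.nonempty
  refine Region.eq_of_mem (R.mem_of_sameSide hx ?_) hy
  rintro K (⟨a, b, hab, rfl⟩ | ⟨i, j, hij, rfl⟩)
  · refine ⟨a, b, 0, rfl, sameSide_zero_of_lt_iff
      (injective_of_mem_complement (cox_subset_shi n) (R.subset hx)) (fun i j => ?_) hab.ne⟩
    rw [shiPerm_lt_iff R hx, shiPerm_lt_iff R' hy, hp]
  · refine ⟨i, j, 1, rfl, SameSide.of_lt_iff (shi_sub_ne (R.subset hx) hij)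
      (shi_sub_ne (R'.subset hy) hij) ?_⟩
    rw [shi_sub_lt_iff R hx hij, shi_sub_lt_iff R' hy hij, hp, hw]

/-! ### From parking functions to Shi regions -/

theorem exists_card_filter_lt {S : Finset ℝ} {m : ℕ} (hm : m ≤ #S) (T : Finset ℝ) :
    ∃ σ ∉ T, #{s ∈ S | s < σ} = m := by
  -- `L` consists of the `m` smallest elements; σ is then taken from an open interval between `L`
  -- and the rest, which is infinite and so avoids `T`.
  obtain ⟨L, hLS, hLm, hL⟩ : ∃ L ⊆ S, #L = m ∧ ∀ l ∈ L, ∀ u ∈ S \ L, l < u := by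
    induction m with
    | zero => exact ⟨∅, by simp, by simp, by simp⟩
    | succ m ih =>
      obtain ⟨L, hLS, hLm, hL⟩ := ih (by omega)
      have hne : (S \ L).Nonempty := by
        rw [← card_pos, card_sdiff_of_subset hLS]
        omega
      have hmin := min'_mem _ hne
      refine ⟨insert ((S \ L).min' hne) L, insert_subset (mem_sdiff.1 hmin).1 hLS, ?_, ?_⟩
      · rw [card_insert_of_notMem (mem_sdiff.1 hmin).2, hLm]
      · intro l hl u hu
        rw [mem_sdiff, mem_insert, not_or] at hu
        have huS : u ∈ S \ L := mem_sdiff.2 ⟨hu.1, hu.2.2⟩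
        rcases mem_insert.1 hl with rfl | hl
        · exact lt_of_le_of_ne (min'_le _ _ huS) (Ne.symm hu.2.1)
        · exact hL l hl u huS
  obtain ⟨m₁, h1, h2⟩ := Order.exists_between_finsets L (S \ L) hL
  obtain ⟨m₂, h3, h4⟩ := Order.exists_between_finsets ({m₁} : Finset ℝ) (S \ L) (by simpa using h2)
  obtain ⟨σ, hσ, hσT⟩ := (Set.Ioo_infinite (h3 m₁ (mem_singleton_self _))).exists_notMem_finset T
  refine ⟨σ, hσT, ?_⟩
  rw [← hLm]
  congr 1
  ext s
  rw [mem_filter]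
  constructor
  · rintro ⟨hs, hlt⟩
    by_contra hsL
    exact lt_asymm hlt (hσ.2.trans (h4 s (mem_sdiff.2 ⟨hs, hsL⟩)))
  · exact fun hs => ⟨hLS hs, (h1 s hs).trans hσ.1⟩

/-- The number of earlier indices carrying the same letter. -/
def occurrence {n : ℕ} (w : Fin n → ℕ) (i : Fin n) : ℕ := #{l | l < i ∧ w l = w i}

theorem IsNext.occurrence_eq {n : ℕ} {w : Fin n → ℕ} {i j : Fin n} (h : IsNext w i j) :
    occurrence w j = occurrence w i + 1 := by
  unfold occurrence
  rw [← card_insert_of_notMem (a := i) (by simp)]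
  congr 1
  ext l
  simp only [mem_filter, mem_univ, true_and, mem_insert]
  constructor
  · rintro ⟨h1, h2⟩
    rcases lt_trichotomy l i with hlt | heq | hlt
    · exact Or.inr ⟨hlt, h2.trans h.2.1.symm⟩
    · exact Or.inl heq
    · exact absurd (h2.trans h.2.1.symm) (h.2.2 l hlt h1)
  · rintro (rfl | ⟨h1, h2⟩)
    · exact ⟨h.1, h.2.1⟩
    · exact ⟨h1.trans h.1, h2.trans h.2.1⟩

theorem occurrence_lt {n : ℕ} {w : Fin n → ℕ} {i j : Fin n} (hij : i < j) (hw : w i = w j) :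
    occurrence w i < occurrence w j := by
  refine card_lt_card ((ssubset_iff_of_subset fun l hl => ?_).2 ⟨i, by simp [hij, hw], by simp⟩)
  simp only [mem_filter, mem_univ, true_and] at hl ⊢
  exact ⟨hl.1.trans hij, hl.2.trans hw⟩

theorem occurrence_inj {n : ℕ} {w : Fin n → ℕ} {i j : Fin n} (hw : w i = w j)
    (h : occurrence w i = occurrence w j) : i = j := by
  rcases lt_trichotomy i j with hlt | he | hlt
  · exact absurd h (occurrence_lt hlt hw).ne
  · exact he
  · exact absurd h (occurrence_lt hlt hw.symm).ne'

/-- The occurrences of a letter `a` happen at times `s a, s a + 1, …`, all times being distinct, and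
exactly `a - 1` events must precede `s a`. Letters are inserted in increasing order; the parking
condition supplies enough earlier events. -/
theorem exists_starting_times {n : ℕ} {w : Fin n → ℕ} (hw : IsParking n w) (k : ℕ) :
    ∃ s : ℕ → ℝ, (∀ i j, w i < k → w j < k →
        s (w i) + occurrence w i = s (w j) + occurrence w j → i = j) ∧
      ∀ i, w i < k → occurrence w i = 0 →
        w i = #{j | w j < k ∧ s (w j) + occurrence w j < s (w i) + occurrence w i} + 1 := by
  classical
  rw [isParking_iff] at hw
  induction k with
  | zero => exact ⟨0, by simp, by simp⟩
  | succ k ih =>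
    obtain ⟨s, hinj, hrank⟩ := ih
    by_cases hk : ∃ i, w i = k
    · obtain ⟨i₀, hi₀⟩ := hk
      obtain ⟨hk1, hkn⟩ := hi₀ ▸ hw.1 i₀
      let y : Fin n → ℝ := fun i => s (w i) + occurrence w i
      let V : Finset (Fin n) := {j | w j < k}
      have hV : ∀ j, j ∈ V ↔ w j < k := fun j => by simp [V]
      have hyV : Set.InjOn y V := fun i hi j hj he => hinj i j ((hV i).1 hi) ((hV j).1 hj) he
      have hcard : k - 1 ≤ #(V.image y) := by
        rw [card_image_of_injOn hyV]
        refine (hw.2 (k - 1) (by omega)).trans (card_le_card fun j hj => ?_)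
        rw [mem_filter] at hj
        rw [hV]
        omega
      -- Avoiding all these differences keeps the new occurrences from colliding with events already
      -- placed.
      obtain ⟨σ, hσT, hσ⟩ := exists_card_filter_lt hcard
        ((univ ×ˢ univ).image fun q : Fin n × Fin n => y q.1 - occurrence w q.2)
      have hσne : ∀ i j, y i ≠ σ + occurrence w j := fun i j he =>
        hσT (mem_image.2 ⟨(i, j), by simp, by simp only [he]; ring⟩)
      have hσcard : #{j | w j < k ∧ y j < σ} = k - 1 := by
        rw [← hσ, Finset.filter_image, card_image_of_injOn]
        · rw [Finset.filter_filter]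
        · exact hyV.mono (by intro j hj; exact mem_coe.2 (mem_filter.1 hj).1)
      let s' : ℕ → ℝ := Function.update s k σ
      have hs'k : s' k = σ := Function.update_self _ _ _
      have hs' : ∀ j, w j < k → s' (w j) = s (w j) := fun j hj =>
        Function.update_of_ne hj.ne _ _
      -- A first occurrence at or after σ would have at least `k - 1` predecessors and hence letter
      -- at least `k`. So all earlier starting times precede σ, and the new events leave their ranks
      -- unchanged.
      have hyσ : ∀ i, w i < k → occurrence w i = 0 → y i < σ := by
        intro i hi h0
        by_contra hle
        have h1 := hrank i hi h0
        have h2 : #{j | w j < k ∧ y j < σ} ≤ #{j | w j < k ∧ y j < y i} := by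
          refine card_le_card fun j hj => ?_
          simp only [mem_filter, mem_univ, true_and] at hj ⊢
          exact ⟨hj.1, hj.2.trans_le (not_lt.1 hle)⟩
        rw [hσcard] at h2
        change w i = #{j | w j < k ∧ y j < y i} + 1 at h1
        omega
      have hcount : ∀ t ≤ σ, #{j | w j < k + 1 ∧ s' (w j) + occurrence w j < t} =
          #{j | w j < k ∧ y j < t} := by
        intro t ht
        congr 1
        ext j
        simp only [mem_filter, mem_univ, true_and]
        constructor
        · rintro ⟨h1, h2⟩
          rcases (Nat.lt_succ_iff.1 h1).eq_or_lt with h3 | h3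
          · rw [h3, hs'k] at h2
            have : (0 : ℝ) ≤ occurrence w j := by positivity
            linarith
          · rw [hs' j h3] at h2
            exact ⟨h3, h2⟩
        · rintro ⟨h1, h2⟩
          rw [hs' j h1]
          exact ⟨by omega, h2⟩
      refine ⟨s', ?_, ?_⟩
      · intro i j hi hj he
        rcases (Nat.lt_succ_iff.1 hi).eq_or_lt with h1 | h1 <;>
          rcases (Nat.lt_succ_iff.1 hj).eq_or_lt with h2 | h2
        · rw [h1, h2] at he
          exact occurrence_inj (h1.trans h2.symm) (by exact_mod_cast add_left_cancel he)
        · rw [h1, hs'k, hs' j h2] at he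
          exact absurd he.symm (hσne j i)
        · rw [h2, hs'k, hs' i h1] at he
          exact absurd he (hσne i j)
        · rw [hs' i h1, hs' j h2] at he
          exact hinj i j h1 h2 he
      · intro i hi h0
        rcases (Nat.lt_succ_iff.1 hi).eq_or_lt with h1 | h1
        · have e : s' (w i) + occurrence w i = σ := by rw [h1, hs'k, h0]; simp
          rw [e, hcount σ le_rfl, hσcard]
          omega
        · rw [hs' i h1]
          refine (hrank i h1 h0).trans ?_
          rw [hcount _ (hyσ i h1 h0).le]
    · have hlt : ∀ i, w i < k + 1 ↔ w i < k := fun i =>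
        ⟨fun h => lt_of_le_of_ne (Nat.lt_succ_iff.1 h) fun he => hk ⟨i, he⟩, fun h => by omega⟩
      simp only [hlt]
      exact ⟨s, hinj, hrank⟩

theorem exists_isShiOrder {n : ℕ} {w : Fin n → ℕ} (hw : IsParking n w) :
    ∃ p, IsShiOrder w p := by
  classical
  obtain ⟨s, hinj, hrank⟩ := exists_starting_times hw (n + 1)
  have hwn : ∀ i, w i < n + 1 := fun i => Nat.lt_succ_of_le (hw.1 i).2
  simp only [hwn, true_and, forall_true_left] at hinj hrank
  let y : Fin n → ℝ := fun i => s (w i) + occurrence w i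
  let q : Fin n → ℕ := fun i => #{j | y j < y i}
  have hqn : ∀ i, q i < n := by
    intro i
    have : q i < #(univ : Finset (Fin n)) :=
      card_lt_card ((ssubset_iff_of_subset (subset_univ _)).2 ⟨i, mem_univ _, by simp⟩)
    simpa using this
  have hq : ∀ i j, y i < y j → q i < q j := by
    intro i j hij
    refine card_lt_card ((ssubset_iff_of_subset fun l hl => ?_).2 ⟨i, by simp [hij], by simp⟩)
    simp only [mem_filter, mem_univ, true_and] at hl ⊢
    exact hl.trans hij
  have hq' : ∀ i j, q i < q j → y i < y j := by
    intro i j hij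
    rcases lt_trichotomy (y i) (y j) with h | h | h
    · exact h
    · rw [hinj i j h] at hij
      exact absurd hij (lt_irrefl _)
    · exact absurd (hq j i h) hij.not_gt
  let p : Fin n → Fin n := fun i => ⟨q i, hqn i⟩
  have hp : Function.Injective p := by
    intro i j he
    have he' : q i = q j := congrArg Fin.val he
    rcases lt_trichotomy (y i) (y j) with h | h | h
    · exact absurd he' (hq i j h).ne
    · exact hinj i j h
    · exact absurd he' (hq j i h).ne'
  -- Consecutive equal letters are exactly one time unit apart, so arcs point forward and cannot
  -- nest.
  have hnext : ∀ i j, IsNext w i j → y j = y i + 1 := by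
    intro i j hij
    simp only [y]
    rw [hij.occurrence_eq, hij.2.1]
    push_cast
    ring
  refine ⟨Equiv.ofBijective p (Finite.injective_iff_bijective.1 hp), ?_, ?_, ?_⟩
  · intro i hi
    refine hrank i (card_eq_zero.2 (filter_eq_empty_iff.2 ?_))
    rintro l - ⟨h1, h2⟩
    exact hi l h1 h2
  · intro i j hij
    exact hq i j (by rw [hnext i j hij]; linarith)
  · intro i j i' j' hij hij' hlt
    refine hq j j' ?_
    rw [hnext i j hij, hnext i' j' hij']
    linarith [hq' i i' hlt]

theorem shiLabel_surjective (n : ℕ) : Function.Surjective (shiLabel n) := by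
  rintro ⟨w, hw⟩
  obtain ⟨p, hp⟩ := exists_isShiOrder hw
  -- The close pairs are those enclosed by an arc; since arcs do not nest, the arcs are precisely
  -- the maximal ones.
  obtain ⟨x, hxc, hord, hclose⟩ := exists_shi_point p
    (fun i j => ∃ a b, IsNext w a b ∧ p a ≤ p i ∧ p j ≤ p b) (by
      rintro i j i' j' - - - - ⟨a, b, hab, h1, h2⟩ h3 h4
      exact ⟨a, b, hab, h1.trans h3, h4.trans h2⟩)
  have hordle : ∀ i j, x j ≤ x i ↔ p i ≤ p j := fun i j => by rw [← not_lt, hord, not_lt]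
  obtain ⟨R, hxR⟩ := exists_region_of_mem hxc
  have hperm : (shiPerm R).symm = p := by
    refine eq_of_first_difference fun i i' hii hag => ?_
    by_contra hne
    rcases lt_or_gt_of_ne ((shiPerm R).symm.injective.ne hne) with h | h
    · have h1 := (hord i i').1 ((shiPerm_lt_iff R hxR i i').2 h)
      rw [← hii] at h1
      rw [hag i (Or.inr h1)] at h1
      exact lt_irrefl _ h1
    · have h1 := hag i' (Or.inl h)
      rw [h1, hii] at h
      exact lt_irrefl _ h
  have hceil : ∀ i j, IsCeiling (shi n) R.1 (diffHyperplane i j 1) ↔ IsNext w i j := by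
    intro i j
    rw [shi_isCeiling_iff R hxR]
    constructor
    · rintro ⟨hij, hji, hlt, hmax⟩
      obtain ⟨a, b, hab, h1, h2⟩ := (hclose i j hij ((hord i j).1 hji)).1 hlt
      obtain ⟨rfl, rfl⟩ := hmax a b hab.1 ((hordle a i).2 h1) ((hordle j b).2 h2)
        ((hclose a b hab.1 (hp.lt a b hab)).2 ⟨a, b, hab, le_rfl, le_rfl⟩)
      exact hab
    · intro h
      have hpij := hp.lt i j h
      refine ⟨h.1, (hord i j).2 hpij, (hclose i j h.1 hpij).2 ⟨i, j, h, le_rfl, le_rfl⟩, ?_⟩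
      intro i' j' hij' hi hj hlt
      rw [hordle] at hi hj
      obtain ⟨a, b, hab, h1, h2⟩ := (hclose i' j' hij' ((hi.trans_lt hpij).trans_le hj)).1 hlt
      have hai : a = i := by
        rcases (h1.trans hi).eq_or_lt with h3 | h3
        · exact p.injective h3
        · exact absurd (hp.nonnesting _ _ _ _ hab h h3) (hj.trans h2).not_gt
      subst hai
      obtain rfl := hab.right_unique h
      exact ⟨p.injective (le_antisymm hi h1), p.injective (le_antisymm h2 hj)⟩
  refine ⟨R, Subtype.ext (funext fun i => ?_)⟩
  change shiWord R i = w i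
  -- Both words agree on first occurrences, and both carry letters unchanged along each arc.
  induction i using WellFoundedLT.induction with
  | _ i ih =>
    by_cases hi : ∀ l, l < i → w l ≠ w i
    · rw [shiWord_eq_position R fun a ha => ?_, hperm, hp.first i hi]
      rw [hceil] at ha
      exact hi a ha.1 ha.2.1
    · push Not at hi
      obtain ⟨l, hl, hlw⟩ := hi
      obtain ⟨a, ha⟩ := exists_isNext_left hl hlw
      rw [← shiWord_eq_of_isCeiling R ((hceil a i).2 ha), ih a ha.1, ha.2.1]

theorem shiLabel_bijective (n : ℕ) : Function.Bijective (shiLabel n) :=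
  ⟨shiLabel_injective n, shiLabel_surjective n⟩

end

end ShiIsh

theorem mainTheorem1 (n : ℕ) [NeZero n] :
    ∃ ω : ShiIsh.Park n ≃ ShiIsh.Region (ShiIsh.shi n),
      (∀ R, ω.symm R = ShiIsh.shiLabel n R) ∧
      Function.Bijective (ω ∘ ShiIsh.alpha n ∘ ShiIsh.rho n) := by
  let e := Equiv.ofBijective (ShiIsh.shiLabel n) (ShiIsh.shiLabel_bijective n)
  exact ⟨e.symm, fun R => rfl, e.symm.bijective.comp
    ((ShiIsh.alpha_bijective n).comp (ShiIsh.rho_bijective n))⟩
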